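/- Let $n\ge 0$, let $\mathbb{F}=\mathbb{Q}(q,t)$ and $\mathbb{K}=\mathbb{Q}(q,t,a)$ be fields of rational functions, and let $\mathcal{C}_n=(\mathbb{Z}_{\ge 0})^n$, with $|\alpha|=\alpha_1+\cdots+\alpha_n$ for $\alpha\in\mathcal{C}_n$. For $v\in\mathbb{Z}^n$ define $\overline{v},\widetilde{v}\in\mathbb{F}^n$ by $$\overline{v}_i=q^{v_i}t^{-k_i(v)},\qquad k_i(v)=\#\{k<i\mid v_k\ge v_i\}+\#\{k>i\mid v_k>v_i\},\qquad \widetilde{v}=\overline{(-v_n,\ldots,-v_1)},$$ and put $\tau=(1,t^{-1},\ldots,t^{1-n})$. For every $\alpha\in\mathcal{C}_n$ there is a unique polynomial $G_\alpha\in\mathbb{F}[x_1,\ldots,x_n]$ of degree at most $|\alpha|$ such that the coefficient of $x^\alpha=x_1^{\alpha_1}\cdots x_n^{\alpha_n}$ in $G_\alpha$ is $1$ and $G_\alpha(\overline{\beta})=0$ for all $\beta\in\mathcal{C}_n$ with $|\beta|\le|\alpha|$ and $\beta\ne\alpha$ (the non-symmetric interpolation Macdonald polynomial). There is also a unique polynomial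 $G'_\alpha\in\mathbb{F}[x_1,\ldots,x_n]$ of degree at most $|\alpha|$ with the same homogeneous component of degree $|\alpha|$ as $G_\alpha$ and such that $G'_\alpha(\widetilde{\beta})=0$ for all $\beta\in\mathcal{C}_n$ with $|\beta|<|\alpha|$ (the primed interpolation polynomial). For $\alpha\in\mathcal{C}_n$ and a box $s=(i,j)$ of $\alpha$ (that is, $1\le i\le n$ and $1\le j\le\alpha_i$) let $a(s)=\alpha_i-j$ and $$l(s)=\#\{k>i\mid j\le\alpha_k\le\alpha_i\}+\#\{k<i\mid j\le\alpha_k+1\le\alpha_i\},$$ and set $n(\alpha)=\sum_{s\in\alpha}l(s)$, $n'(\alpha)=\sum_{s\in\alpha}a(s)$. Let $\alpha^+$ be the non-increasing rearrangement of $\alpha$, and let $$\tau_\alpha=(-1)^{|\alpha|}q^{n'(\alpha)}t^{-n(\alpha^+)}.$$ Then for all $\alpha\in\mathcal{C}_n$ the following identity holds in $\mathbb{K}$: $$G'_\alpha(a^{-1}\tau)=\tau_\alpha^{-1}\,a^{-|\alpha|}\,G_\alpha(a\tau).$$ -/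

import Mathlib

noncomputable section

namespace InterpolationMacdonald

open MvPolynomial

/-- The field `𝔽 = ℚ(q,t)` of rational functions in two variables over `ℚ`. -/
abbrev BaseField : Type := FractionRing (MvPolynomial (Fin 2) ℚ)

/-- The field `𝕂 = ℚ(q,t,a) = 𝔽(a)`. -/
abbrev ParamField : Type := RatFunc BaseField

/-- The variable `q` of `𝔽 = ℚ(q,t)`. -/
def q : BaseField := algebraMap (MvPolynomial (Fin 2) ℚ) BaseField (X 0)

/-- The variable `t` of `𝔽 = ℚ(q,t)`. -/
def t : BaseField := algebraMap (MvPolynomial (Fin 2) ℚ) BaseField (X 1)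

/-- The variable `a` of `𝕂 = 𝔽(a)`. -/
def a : ParamField := RatFunc.X

/-- `|α| = α₁ + ⋯ + αₙ`. -/
def size {n : ℕ} (α : Fin n → ℕ) : ℕ := ∑ i, α i

/-- `k_i(v) = #{k < i | v_k ≥ v_i} + #{k > i | v_k > v_i}`. -/
def kIndex {n : ℕ} (v : Fin n → ℤ) (i : Fin n) : ℕ :=
  (Finset.univ.filter fun k : Fin n => k < i ∧ v i ≤ v k).card +
    (Finset.univ.filter fun k : Fin n => i < k ∧ v i < v k).card

/-- The spectral vector `v̄` with entries `v̄_i = q^{v_i} t^{-k_i(v)}`. -/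
def bar {n : ℕ} (v : Fin n → ℤ) : Fin n → BaseField :=
  fun i => q ^ v i * t ^ (-(kIndex v i : ℤ))

/-- `ṽ`, the spectral vector of `-w₀v`, where `w₀` reverses the entries. -/
def tilde {n : ℕ} (v : Fin n → ℤ) : Fin n → BaseField :=
  bar fun i => -v i.rev

/-- `τ = (1, t⁻¹, …, t^{1-n})`; the entries are indexed from `0`. -/
def tau (n : ℕ) : Fin n → BaseField :=
  fun i => t ^ (-(i : ℤ))

/-- A composition, viewed as an integral vector. -/
def toInt {n : ℕ} (β : Fin n → ℕ) : Fin n → ℤ := fun i => (β i : ℤ)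

/-- The characterizing properties of the interpolation polynomial `G_α`: degree at most `|α|`,
vanishing at `β̄` for all compositions `β ≠ α` with `|β| ≤ |α|`, and coefficient `1` at `x^α`. -/
structure IsInterpolation {n : ℕ} (α : Fin n → ℕ) (P : MvPolynomial (Fin n) BaseField) :
    Prop where
  degree_le : P.totalDegree ≤ size α
  vanishing : ∀ β : Fin n → ℕ, size β ≤ size α → β ≠ α → eval (bar (toInt β)) P = 0
  normalized : P.coeff (Finsupp.equivFunOnFinite.symm α) = 1

/-- The non-symmetric interpolation Macdonald polynomial `G_α(x) = G_α(x;q,t)`. -/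
def G {n : ℕ} (α : Fin n → ℕ) : MvPolynomial (Fin n) BaseField :=
  Classical.epsilon (IsInterpolation α)

/-- The characterizing properties of the primed interpolation polynomial `G'_α`: degree at most
`|α|`, the same homogeneous component of degree `|α|` as `G_α`, and vanishing at `β̃` for all
compositions `β` with `|β| < |α|`. -/
structure IsPrimedInterpolation {n : ℕ} (α : Fin n → ℕ)
    (P : MvPolynomial (Fin n) BaseField) : Prop where
  degree_le : P.totalDegree ≤ size α
  top_eq : homogeneousComponent (size α) P = homogeneousComponent (size α) (G α)
  vanishing : ∀ β : Fin n → ℕ, size β < size α → eval (tilde (toInt β)) P = 0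

/-- The primed interpolation polynomial `G'_α(x) = G'_α(x;q,t)`. -/
def GPrime {n : ℕ} (α : Fin n → ℕ) : MvPolynomial (Fin n) BaseField :=
  Classical.epsilon (IsPrimedInterpolation α)

/-- The leg `l(s)` of the box `s = (i,j)` of `α`, with columns `j` counted from `1`. -/
def leg {n : ℕ} (α : Fin n → ℕ) (i : Fin n) (j : ℕ) : ℕ :=
  (Finset.univ.filter fun k : Fin n => i < k ∧ j ≤ α k ∧ α k ≤ α i).card +
    (Finset.univ.filter fun k : Fin n => k < i ∧ j ≤ α k + 1 ∧ α k + 1 ≤ α i).card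

/-- `n(α) = ∑_{s ∈ α} l(s)`. -/
def legSum {n : ℕ} (α : Fin n → ℕ) : ℕ :=
  ∑ i, ∑ j ∈ Finset.Icc 1 (α i), leg α i j

/-- `n'(α) = ∑_{s ∈ α} a(s)`, with arm `a(s) = α_i - j` for `s = (i,j)`, `1 ≤ j ≤ α_i`. -/
def armSum {n : ℕ} (α : Fin n → ℕ) : ℕ :=
  ∑ i, ∑ j ∈ Finset.Icc 1 (α i), (α i - j)

/-- The non-increasing rearrangement `α⁺` of `α`. -/
def plus {n : ℕ} (α : Fin n → ℕ) : Fin n → ℕ :=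
  fun i => α (Tuple.sort (fun k => OrderDual.toDual (α k)) i)

/-- `τ_α = (-1)^{|α|} q^{n'(α)} t^{-n(α⁺)}`. -/
def tauComp {n : ℕ} (α : Fin n → ℕ) : BaseField :=
  (-1) ^ size α * q ^ armSum α * t ^ (-(legSum (plus α) : ℤ))

/-- The value `P(c τ) ∈ 𝕂` of a polynomial `P` over `𝔽` at `c τ`, where `c ∈ 𝕂`. -/
def evalTau {n : ℕ} (P : MvPolynomial (Fin n) BaseField) (c : ParamField) : ParamField :=
  aeval (fun i => c * algebraMap BaseField ParamField (tau n i)) P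

end InterpolationMacdonald

end

/-! On the line `c τ` both polynomials split into linear factors in `c`. The roots of `G_α` are `q^j
t^{-i}`, one for each `i < cnt α j` (the boxes of `α⁺` counted from zero); those of `G'_α` are the
inverses. Both leading coefficients are the value at `τ` of the common top component, so the
identity reduces to `x⁻¹ - r⁻¹ = -(x r)⁻¹ (x - r)`, and the product of the roots supplies `τ_α`.

Roots of `G_α` (`eval_basis_root`). Operators `Z_i = T_i ⋯ T_{n-1} Φ T_1 ⋯ T_{i-1}`, with `T_i` the
Demazure–Lusztig operators and `Φ` affine, satisfy `G_α + Z_i G_α = ᾱ_i⁻¹ x_i G_α` (`opZ_basis`).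
They propagate vanishing, which yields extra zeros: `G_α(β̄) = 0` as soon as, for some `j`, fewer
entries of `β` than of `α` exceed `j` (`eval_basis_of_cnt_lt`). To vanish at `q^j t^{-i} τ`, append
`i` zeros to `α` and join the resulting point to the spectral vectors of `(j^n, M^i)`, `M > j`, by a
line: the extra zeros are infinitely many on it.

Roots of `G'_α` (`eval_primed_root`). After reversing and rescaling the variables, `G'_α` vanishes
at the spectral vectors of size below `|α|` for `q⁻¹, t⁻¹`, and its top component is a multiple of
the reversed leading form of `G_α`. That form lies in the span of the leading forms, for inverted
parameters, of the `G_β` with `|β| = |α|` and the same spectral sum (`rv_lead_mem`). Such `β` are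
rearrangements of `α`, so the first root computation applies to each `G_β`.

For `rv_lead_mem`, leading forms are joint eigenvectors of Cherednik operators. The sum of all
leading forms in the orbit is symmetric, and on symmetric polynomials the sums of the operators for
the two parameter choices agree (`sum_opY_inv`); this puts the sum in the span. The span is stable
under the operators, and separation of joint eigenvalues extracts the single leading form. -/

noncomputable section

namespace NonsymInterp

open MvPolynomial

/-! ### Divisibility, homogeneous components and degrees -/

section Poly
variable {σ F : Type*} [Field F]

/-- Modulo `p` the homomorphisms `φ` and `id` agree on generators. All divisibilities below come
from this: by `x_i - x_{i+1}` for divided differences, by `x_n - c` for restriction, and by `x_i`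
for the operators `Ξ_i`. -/
theorem dvd_sub_map_of_dvd_X (φ : MvPolynomial σ F →ₐ[F] MvPolynomial σ F) (p : MvPolynomial σ F)
    (h : ∀ k, p ∣ X k - φ (X k)) (f : MvPolynomial σ F) : p ∣ f - φ f := by
  have h1 : (Ideal.Quotient.mkₐ F (Ideal.span {p})).comp φ = Ideal.Quotient.mkₐ F (Ideal.span {p}) := by
    apply MvPolynomial.algHom_ext
    intro k
    symm
    simp only [AlgHom.comp_apply, Ideal.Quotient.mkₐ_eq_mk]
    rw [Ideal.Quotient.eq, Ideal.mem_span_singleton]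
    exact h k
  have h2 := congrArg (fun ψ => ψ f) h1
  simp only [AlgHom.comp_apply, Ideal.Quotient.mkₐ_eq_mk] at h2
  rw [← Ideal.mem_span_singleton, ← Ideal.Quotient.eq]
  exact h2.symm

theorem homogeneousComponent_map (L : MvPolynomial σ F →ₗ[F] MvPolynomial σ F) (s : ℕ)
    (hL : ∀ k f, IsHomogeneous f k → IsHomogeneous (L f) (k + s)) (f : MvPolynomial σ F) (k : ℕ) :
    homogeneousComponent (k + s) (L f) = L (homogeneousComponent k f) := by
  conv_lhs => rw [← sum_homogeneousComponent f]
  rw [map_sum, map_sum]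
  by_cases hk : k ∈ Finset.range (f.totalDegree + 1)
  · rw [Finset.sum_eq_single_of_mem k hk]
    · rw [homogeneousComponent_of_mem (hL k _ (homogeneousComponent_isHomogeneous k f))]
      simp
    · intro j _ hj
      rw [homogeneousComponent_of_mem (hL j _ (homogeneousComponent_isHomogeneous j f))]
      simp [hj.symm]
  · rw [Finset.sum_eq_zero]
    · rw [homogeneousComponent_eq_zero, map_zero]
      simpa using hk
    · intro j hj
      rw [homogeneousComponent_of_mem (hL j _ (homogeneousComponent_isHomogeneous j f)), if_neg]
      rintro h
      exact hk (by rwa [show k = j by omega])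

theorem homogeneousComponent_mul_left {l : MvPolynomial σ F} {s : ℕ} (hl : IsHomogeneous l s)
    (f : MvPolynomial σ F) (k : ℕ) :
    homogeneousComponent (k + s) (l * f) = l * homogeneousComponent k f :=
  homogeneousComponent_map (LinearMap.mulLeft F l) s
    (fun k f hf => by simpa [add_comm] using hl.mul hf) f k

theorem isHomogeneous_of_mul_left {l f : MvPolynomial σ F} {s k : ℕ} (hl : IsHomogeneous l s)
    (hl0 : l ≠ 0) (h : IsHomogeneous (l * f) (k + s)) : IsHomogeneous f k := by
  have key : homogeneousComponent k f = f := by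
    apply mul_left_cancel₀ hl0
    rw [← homogeneousComponent_mul_left hl, homogeneousComponent_of_mem h]
    simp
  rw [← key]
  exact homogeneousComponent_isHomogeneous k f

theorem totalDegree_le_of_mul_left {l f : MvPolynomial σ F} {d : ℕ} 
    (hl0 : l ≠ 0) (h : (l * f).totalDegree ≤ l.totalDegree + d) : f.totalDegree ≤ d := by
  by_cases hf : f = 0
  · simp [hf]
  · rw [totalDegree_mul_of_isDomain hl0 hf] at h
    omega

theorem totalDegree_lt_of_homogeneousComponent_eq_zero {f : MvPolynomial σ F} {d : ℕ}
    (hd : f.totalDegree ≤ d + 1) (h : homogeneousComponent (d + 1) f = 0) : f.totalDegree ≤ d := by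
  rw [← sum_homogeneousComponent f]
  refine totalDegree_finsetSum_le fun i hi => ?_
  rcases Nat.lt_or_ge d i with h1 | h1
  · have : i = d + 1 := by simp at hi; omega
    rw [this, h]; simp
  · exact (homogeneousComponent_isHomogeneous i f).totalDegree_le.trans h1

end Poly

/-! ### From uniqueness to existence of interpolants -/

section Interp
variable {F : Type*} [Field F] {n : ℕ}

/-- The size of a composition. -/
abbrev sz (β : Fin n → ℕ) : ℕ := ∑ i, β i

theorem finite_sz_le (n d : ℕ) : {γ : Fin n → ℕ | sz γ ≤ d}.Finite := by
  refine (Set.Finite.pi' (t := fun _ : Fin n => Set.Iic d) fun _ => Set.finite_Iic d).subset ?_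
  intro γ hγ i
  exact (Finset.single_le_sum (f := γ) (fun _ _ => Nat.zero_le _) (Finset.mem_univ i)).trans hγ

theorem degree_symm (γ : Fin n → ℕ) :
    (Finsupp.equivFunOnFinite.symm γ).degree = sz γ := by
  simp [Finsupp.degree_eq_sum]

/-- The linear system is square: monomials of degree at most `d` and conditions are indexed by the
same compositions, so injectivity gives surjectivity. -/
theorem exists_of_unique (d : ℕ) (Λ : (Fin n → ℕ) → (MvPolynomial (Fin n) F →ₗ[F] F))
    (h : ∀ f, f.totalDegree ≤ d → (∀ β, sz β ≤ d → Λ β f = 0) → f = 0) (c : (Fin n → ℕ) → F) :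
    ∃ f, f.totalDegree ≤ d ∧ ∀ β, sz β ≤ d → Λ β f = c β := by
  classical
  let ι := {γ : Fin n → ℕ // sz γ ≤ d}
  have : Fintype ι := (finite_sz_le n d).fintype
  let P : (ι → F) →ₗ[F] MvPolynomial (Fin n) F :=
    ∑ γ : ι, (monomial (Finsupp.equivFunOnFinite.symm γ.1)) ∘ₗ (LinearMap.proj γ)
  have hP (v : ι → F) : P v = ∑ γ : ι, monomial (Finsupp.equivFunOnFinite.symm γ.1) (v γ) := by
    simp [P]
  have hdeg (v : ι → F) : (P v).totalDegree ≤ d := by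
    rw [hP]
    refine totalDegree_finsetSum_le fun γ _ => ?_
    refine (totalDegree_monomial_le _ _).trans ?_
    have := degree_symm γ.1
    have h2 := γ.2
    rw [← this, Finsupp.degree] at h2
    exact h2
  have hinj : Function.Injective P := by
    rw [← LinearMap.ker_eq_bot, LinearMap.ker_eq_bot']
    intro v hv
    ext γ
    have := congrArg (coeff (Finsupp.equivFunOnFinite.symm γ.1)) hv
    rw [hP, coeff_sum] at this
    simp only [coeff_monomial, coeff_zero, EmbeddingLike.apply_eq_iff_eq] at this
    rw [Finset.sum_eq_single γ] at this
    · simpa using this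
    · intro b _ hb
      rw [if_neg]
      exact fun hh => hb (Subtype.ext hh)
    · simp
  let M : (ι → F) →ₗ[F] (ι → F) := LinearMap.pi fun β => (Λ β.1) ∘ₗ P
  have hM : Function.Injective M := by
    rw [← LinearMap.ker_eq_bot, LinearMap.ker_eq_bot']
    intro v hv
    apply hinj
    rw [map_zero]
    apply h _ (hdeg v)
    intro β hβ
    exact congrFun hv ⟨β, hβ⟩
  obtain ⟨v, hv⟩ := (LinearMap.injective_iff_surjective.mp hM) fun β => c β.1
  exact ⟨P v, hdeg v, fun β hβ => congrFun hv ⟨β, hβ⟩⟩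

end Interp

/-! ### Spectral vectors and generic parameters -/

section Spec
variable {n : ℕ}

/-- `k` precedes `i` in the order which lists the entries of `β` decreasingly, ties from the left. -/
def dom (β : Fin n → ℕ) (k i : Fin n) : Prop := β i < β k ∨ (β i = β k ∧ k < i)

instance (β : Fin n → ℕ) (k i : Fin n) : Decidable (dom β k i) := by unfold dom; infer_instance

/-- The number of entries preceding the `i`-th one. -/
def rank (β : Fin n → ℕ) (i : Fin n) : ℕ := ∑ k, if dom β k i then 1 else 0

/-- The composition `(β₂, …, βₙ, β₁ + 1)`. -/
def raise (β : Fin (n + 1) → ℕ) : Fin (n + 1) → ℕ := Fin.snoc (fun k => β k.succ) (β 0 + 1)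

@[simp] theorem raise_last (β : Fin (n + 1) → ℕ) : raise β (Fin.last n) = β 0 + 1 := by
  simp [raise]

@[simp] theorem raise_castSucc (β : Fin (n + 1) → ℕ) (i : Fin n) :
    raise β i.castSucc = β i.succ := by
  simp [raise]

theorem sz_raise (β : Fin (n + 1) → ℕ) : sz (raise β) = sz β + 1 := by
  simp only [sz]
  rw [Fin.sum_univ_castSucc, Fin.sum_univ_succ β]
  simp; ring

theorem exists_raise (β : Fin (n + 1) → ℕ) (h : β (Fin.last n) ≠ 0) : ∃ β', raise β' = β := by
  refine ⟨Fin.cons (β (Fin.last n) - 1) (fun k => β k.castSucc), ?_⟩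
  funext i
  refine Fin.lastCases ?_ (fun i => ?_) i
  · simp; omega
  · simp

/-- The increment compensates for the change of place. Only strictly larger entries precede the
first entry, whereas ties also precede the last one, and `β k > β 0` means `β k ≥ β 0 + 1`. -/
theorem rank_raise_last (β : Fin (n + 1) → ℕ) : rank (raise β) (Fin.last n) = rank β 0 := by
  unfold rank
  rw [Fin.sum_univ_castSucc, Fin.sum_univ_succ]
  simp [dom, Fin.castSucc_lt_last]
  congr 1; ext k; simp; omega

theorem rank_raise_castSucc (β : Fin (n + 1) → ℕ) (i : Fin n) :
    rank (raise β) i.castSucc = rank β i.succ := by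
  unfold rank
  rw [Fin.sum_univ_castSucc, Fin.sum_univ_succ]
  simp only [dom, raise_castSucc, raise_last, Fin.castSucc_lt_castSucc_iff, Fin.succ_lt_succ_iff]
  rw [add_comm]
  congr 1
  have h1 : ¬ Fin.last n < i.castSucc := by simp [Fin.le_last]
  have h2 : (0 : Fin (n + 1)) < i.succ := Fin.succ_pos i
  simp only [h1, h2, and_false, and_true, or_false]
  congr 1; simp; omega

theorem rank_snoc_zero_castSucc (β : Fin n → ℕ) (i : Fin n) :
    rank (Fin.snoc β 0 : Fin (n + 1) → ℕ) i.castSucc = rank β i := by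
  unfold rank
  rw [Fin.sum_univ_castSucc]
  have h1 : ¬ Fin.last n < i.castSucc := by simp [Fin.le_last]
  simp [dom, h1]

theorem rank_snoc_zero_last (β : Fin n → ℕ) :
    rank (Fin.snoc β 0 : Fin (n + 1) → ℕ) (Fin.last n) = n := by
  unfold rank
  rw [Fin.sum_univ_castSucc]
  have h1 (i : Fin n) : i.castSucc < Fin.last n := Fin.castSucc_lt_last i
  have h2 (i : Fin n) : 0 < β i ∨ 0 = β i := by omega
  simp [dom, h1, h2]

theorem sz_snoc_zero (β : Fin n → ℕ) : sz (Fin.snoc β 0 : Fin (n + 1) → ℕ) = sz β := by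
  simp [Fin.sum_univ_castSucc]

variable {F : Type*} [Field F] 

/-- The spectral vector of a composition. -/
def spec (q t : F) (β : Fin n → ℕ) : Fin n → F := fun i => q ^ β i * t⁻¹ ^ rank β i

/-- No non-trivial monomial in `q` and `t` equals one. -/
structure Generic (q t : F) : Prop where
  q_ne : q ≠ 0
  t_ne : t ≠ 0
  indep : ∀ a b : ℤ, q ^ a * t ^ b = 1 → a = 0 ∧ b = 0

theorem Generic.inv {q t : F} (h : Generic q t) : Generic q⁻¹ t⁻¹ := by
  refine ⟨inv_ne_zero h.q_ne, inv_ne_zero h.t_ne, fun a b hab => ?_⟩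
  have := h.indep (-a) (-b) (by rw [← hab]; simp)
  omega

theorem Generic.eq_of_eq {q t : F} (h : Generic q t) {a b a' b' : ℤ}
    (he : q ^ a * t ^ b = q ^ a' * t ^ b') : a = a' ∧ b = b' := by
  have := h.indep (a - a') (b - b') (by
    rw [zpow_sub₀ h.q_ne, zpow_sub₀ h.t_ne, div_mul_div_comm, he, div_self]
    exact mul_ne_zero (zpow_ne_zero _ h.q_ne) (zpow_ne_zero _ h.t_ne))
  omega

theorem Generic.eq_of_eq_nat {q t : F} (h : Generic q t) {a b a' b' : ℕ}
    (he : q ^ a * t⁻¹ ^ b = q ^ a' * t⁻¹ ^ b') : a = a' ∧ b = b' := by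
  have := h.eq_of_eq (a := a) (b := -b) (a' := a') (b' := -b') (by simpa using he)
  omega

variable {q t : F}

theorem spec_ne_zero (h : Generic q t) (β : Fin n → ℕ) (i : Fin n) : spec q t β i ≠ 0 :=
  mul_ne_zero (pow_ne_zero _ h.q_ne) (pow_ne_zero _ (inv_ne_zero h.t_ne))

theorem Generic.spec_eq (h : Generic q t) {β γ : Fin n → ℕ} {i j : Fin n}
    (he : spec q t β i = spec q t γ j) : β i = γ j ∧ rank β i = rank γ j :=
  h.eq_of_eq_nat he

theorem spec_raise_last (β : Fin (n + 1) → ℕ) :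
    spec q t (raise β) (Fin.last n) = q * spec q t β 0 := by
  simp only [spec, rank_raise_last, raise_last]
  ring

theorem spec_raise_castSucc (β : Fin (n + 1) → ℕ) (i : Fin n) :
    spec q t (raise β) i.castSucc = spec q t β i.succ := by
  simp only [spec, rank_raise_castSucc, raise_castSucc]

theorem spec_snoc_zero (β : Fin n → ℕ) :
    spec q t (Fin.snoc β 0 : Fin (n + 1) → ℕ) = Fin.snoc (spec q t β) (t⁻¹ ^ n) := by
  funext i
  refine Fin.lastCases ?_ (fun i => ?_) i
  · simp [spec, rank_snoc_zero_last]
  · simp [spec, rank_snoc_zero_castSucc]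

theorem raise_last_ne (h : Generic q t) (β : Fin (n + 1) → ℕ) :
    spec q t (raise β) (Fin.last n) ≠ t⁻¹ ^ n := by
  intro he
  have := (h.eq_of_eq_nat (a := raise β (Fin.last n)) (a' := 0) (b' := n) 
    (by simpa [spec] using he)).1
  simp at this

end Spec

/-! ### The affine shift, restriction of the last variable, and unisolvence -/

section Omega
variable {F : Type*} [Field F] {n : ℕ}

theorem eval_aeval_eq {σ ρ : Type*} (x : ρ → F) (g : σ → MvPolynomial ρ F)
    (f : MvPolynomial σ F) : eval x (aeval g f) = eval (fun k => eval x (g k)) f := by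
  induction f using MvPolynomial.induction_on with
  | C a => simp
  | add p r hp hr => rw [map_add, map_add, map_add, hp, hr]
  | mul_X p k hp => rw [map_mul, map_mul, map_mul, hp, aeval_X, eval_X]

theorem totalDegree_le_of_isHomogeneous_map {σ ρ : Type*}
    (L : MvPolynomial σ F →ₗ[F] MvPolynomial ρ F)
    (hL : ∀ k f, IsHomogeneous f k → IsHomogeneous (L f) k) (f : MvPolynomial σ F) {d : ℕ}
    (hf : f.totalDegree ≤ d) : (L f).totalDegree ≤ d := by
  rw [← sum_homogeneousComponent f, map_sum]
  refine totalDegree_finsetSum_le fun i hi => ?_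
  refine (hL i _ (homogeneousComponent_isHomogeneous i f)).totalDegree_le.trans ?_
  simp at hi; omega

/-- `f(x₁, …, xₙ) ↦ f(xₙ / q, x₁, …, xₙ₋₁)`. -/
def om (q : F) : MvPolynomial (Fin (n + 1)) F →ₐ[F] MvPolynomial (Fin (n + 1)) F :=
  aeval (Fin.cons (C q⁻¹ * X (Fin.last n)) fun k => X k.castSucc)

/-- `f(x₁, …, xₙ) ↦ f(x₂, …, xₙ, q x₁)`. -/
def omInv (q : F) : MvPolynomial (Fin (n + 1)) F →ₐ[F] MvPolynomial (Fin (n + 1)) F :=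
  aeval (Fin.snoc (fun k => X k.succ) (C q * X 0))

@[simp] theorem om_X_zero (q : F) : om q (X 0) = C q⁻¹ * X (Fin.last n) := by simp [om]
@[simp] theorem om_X_succ (q : F) (k : Fin n) : om q (X k.succ) = X k.castSucc := by simp [om]
@[simp] theorem omInv_X_last (q : F) : omInv q (X (Fin.last n)) = C q * X 0 := by simp [omInv]
@[simp] theorem omInv_X_castSucc (q : F) (k : Fin n) : omInv q (X k.castSucc) = X k.succ := by
  simp [omInv]

theorem omInv_om {q : F} (hq : q ≠ 0) (f : MvPolynomial (Fin (n + 1)) F) :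
    omInv q (om q f) = f := by
  have : (omInv q).comp (om q) = AlgHom.id F (MvPolynomial (Fin (n + 1)) F) := by
    apply algHom_ext
    intro k
    refine Fin.cases ?_ (fun k => ?_) k
    · have : (omInv q) (C q⁻¹ : MvPolynomial (Fin (n + 1)) F) = C q⁻¹ := (omInv q).commutes _
      simp only [AlgHom.comp_apply, om_X_zero, map_mul, omInv_X_last, AlgHom.id_apply, this]
      rw [← mul_assoc, ← C_mul, inv_mul_cancel₀ hq]; simp
    · simp
  exact congrArg (fun ψ => ψ f) this

theorem om_omInv {q : F} (hq : q ≠ 0) (f : MvPolynomial (Fin (n + 1)) F) :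
    om q (omInv q f) = f := by
  have : (om q).comp (omInv q) = AlgHom.id F (MvPolynomial (Fin (n + 1)) F) := by
    apply algHom_ext
    intro k
    refine Fin.lastCases ?_ (fun k => ?_) k
    · have : (om q) (C q : MvPolynomial (Fin (n + 1)) F) = C q := (om q).commutes _
      simp only [AlgHom.comp_apply, om_X_zero, map_mul, omInv_X_last, AlgHom.id_apply, this]
      rw [← mul_assoc, ← C_mul, mul_inv_cancel₀ hq]; simp
    · simp
  exact congrArg (fun ψ => ψ f) this

theorem eval_om (q : F) (x : Fin (n + 1) → F) (f) :
    eval x (om q f) = eval (Fin.cons (q⁻¹ * x (Fin.last n)) fun k => x k.castSucc) f := by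
  rw [om, eval_aeval_eq]
  congr 2; funext k
  refine Fin.cases ?_ (fun k => ?_) k <;> simp

theorem eval_omInv (q : F) (x : Fin (n + 1) → F) (f) :
    eval x (omInv q f) = eval (Fin.snoc (fun k => x k.succ) (q * x 0)) f := by
  rw [omInv, eval_aeval_eq]
  congr 2; funext k
  refine Fin.lastCases ?_ (fun k => ?_) k <;> simp

theorem isHomogeneous_om (q : F) (k : ℕ) (f : MvPolynomial (Fin (n + 1)) F)
    (hf : IsHomogeneous f k) : IsHomogeneous (om q f) k := by
  have := hf.aeval (Fin.cons (C q⁻¹ * X (Fin.last n)) fun k => X k.castSucc) (n := 1) (by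
    intro k
    refine Fin.cases ?_ (fun k => ?_) k
    · simpa using (isHomogeneous_C _ q⁻¹).mul (isHomogeneous_X F (Fin.last n))
    · simpa using isHomogeneous_X F _)
  simpa [om] using this

theorem isHomogeneous_omInv (q : F) (k : ℕ) (f : MvPolynomial (Fin (n + 1)) F)
    (hf : IsHomogeneous f k) : IsHomogeneous (omInv q f) k := by
  have := hf.aeval (Fin.snoc (fun k => X k.succ) (C q * X 0)) (n := 1) (by
    intro k
    refine Fin.lastCases ?_ (fun k => ?_) k
    · simpa using (isHomogeneous_C _ q).mul (isHomogeneous_X F (0 : Fin (n + 1)))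
    · simpa using isHomogeneous_X F _)
  simpa [omInv] using this

theorem spec_raise (q t : F) (β : Fin (n + 1) → ℕ) :
    spec q t (raise β) = Fin.snoc (fun k => spec q t β k.succ) (q * spec q t β 0) := by
  funext i
  refine Fin.lastCases ?_ (fun i => ?_) i
  · simp [spec_raise_last]
  · simp [spec_raise_castSucc]

theorem omInv_monomial (q : F) (u : Fin (n + 1) →₀ ℕ) (a : F) :
    omInv q (monomial u a) = monomial (Finsupp.equivFunOnFinite.symm
      (Fin.cons (u (Fin.last n)) fun k => u k.castSucc)) (a * q ^ u (Fin.last n)) := by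
  rw [omInv, aeval_monomial, monomial_eq, Finsupp.prod_fintype _ _ (by simp),
    Finsupp.prod_fintype _ _ (by simp), Fin.prod_univ_castSucc, Fin.prod_univ_succ]
  simp [mul_pow, algebraMap_eq]
  ring

theorem coeff_omInv (q : F) (g : MvPolynomial (Fin (n + 1)) F)
    (γ γ' : Fin (n + 1) → ℕ) (h0 : γ' 0 = γ (Fin.last n))
    (hs : ∀ i : Fin n, γ' i.succ = γ i.castSucc) :
    coeff (Finsupp.equivFunOnFinite.symm γ') (omInv q g) =
      q ^ γ (Fin.last n) * coeff (Finsupp.equivFunOnFinite.symm γ) g := by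
  induction g using MvPolynomial.induction_on' with
  | monomial u a =>
    rw [omInv_monomial, coeff_monomial, coeff_monomial]
    by_cases hu : u = Finsupp.equivFunOnFinite.symm γ
    · subst hu
      rw [if_pos, if_pos rfl]
      · simp [mul_comm]
      · ext i
        refine Fin.cases ?_ (fun i => ?_) i <;> simp [h0, hs]
    · rw [if_neg, if_neg hu, mul_zero]
      intro he
      apply hu
      have he' := DFunLike.congr_fun he
      ext i
      refine Fin.lastCases ?_ (fun i => ?_) i
      · simpa [h0] using he' 0
      · simpa [hs] using he' i.succ
  | add p r hp hr => rw [map_add, coeff_add, coeff_add, hp, hr, mul_add]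

/-- Substitution of a constant for the last variable. -/
def restr (c : F) : MvPolynomial (Fin (n + 1)) F →ₐ[F] MvPolynomial (Fin n) F :=
  aeval (Fin.snoc X (C c))

theorem eval_restr (c : F) (x : Fin n → F) (f : MvPolynomial (Fin (n + 1)) F) :
    eval x (restr c f) = eval (Fin.snoc x c) f := by
  rw [restr, eval_aeval_eq]
  congr 2; funext k
  refine Fin.lastCases ?_ (fun k => ?_) k <;> simp

theorem restr_monomial (c : F) (u : Fin (n + 1) →₀ ℕ) (a : F) :
    restr c (monomial u a) = monomial (Finsupp.equivFunOnFinite.symm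
      fun k => u k.castSucc) (a * c ^ u (Fin.last n)) := by
  rw [restr, aeval_monomial, monomial_eq, Finsupp.prod_fintype _ _ (by simp),
    Finsupp.prod_fintype _ _ (by simp), Fin.prod_univ_castSucc]
  simp [algebraMap_eq]
  ring

theorem restr_eq_sum (c : F) (f : MvPolynomial (Fin (n + 1)) F) :
    restr c f = ∑ u ∈ f.support, monomial (Finsupp.equivFunOnFinite.symm
      fun k => u k.castSucc) (coeff u f * c ^ u (Fin.last n)) := by
  conv_lhs => rw [f.as_sum, map_sum]
  simp only [restr_monomial]

theorem degree_le_of_mem_support {σ : Type*} [Fintype σ] {f : MvPolynomial σ F} {u : σ →₀ ℕ}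
    (hu : u ∈ f.support) : ∑ i, u i ≤ f.totalDegree := by
  have := le_totalDegree hu
  rwa [Finsupp.sum_fintype _ _ (by simp)] at this

theorem totalDegree_restr_le (c : F) (f : MvPolynomial (Fin (n + 1)) F) :
    (restr c f).totalDegree ≤ f.totalDegree := by
  rw [restr_eq_sum]
  refine totalDegree_finsetSum_le fun u hu => (totalDegree_monomial_le _ _).trans ?_
  refine le_trans ?_ (degree_le_of_mem_support hu)
  rw [Fin.sum_univ_castSucc]
  simp [Finsupp.sum_fintype]

/-- Under the degree bound, a monomial that restricts to `x^α` has no degree left for the last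
variable. -/
theorem coeff_restr (c : F) (f : MvPolynomial (Fin (n + 1)) F) (α : Fin n → ℕ)
    (hd : f.totalDegree ≤ sz α) :
    coeff (Finsupp.equivFunOnFinite.symm α) (restr c f) =
      coeff (Finsupp.equivFunOnFinite.symm (Fin.snoc α 0 : Fin (n + 1) → ℕ)) f := by
  rw [restr_eq_sum, coeff_sum]
  simp only [coeff_monomial, EmbeddingLike.apply_eq_iff_eq]
  have key (u) (hu : u ∈ f.support) (h : (fun k : Fin n => u k.castSucc) = α) :
      u = Finsupp.equivFunOnFinite.symm (Fin.snoc α 0 : Fin (n + 1) → ℕ) := by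
    have h1 := (degree_le_of_mem_support hu).trans hd
    rw [Fin.sum_univ_castSucc] at h1
    subst h
    ext i
    refine Fin.lastCases ?_ (fun i => ?_) i
    · simp [sz] at h1 ⊢; omega
    · simp
  by_cases h0 : Finsupp.equivFunOnFinite.symm (Fin.snoc α 0 : Fin (n + 1) → ℕ) ∈ f.support
  · rw [Finset.sum_eq_single_of_mem _ h0]
    · simp
    · intro u hu hne
      rw [if_neg]
      exact fun h => hne (key u hu h)
  · rw [notMem_support_iff.mp h0]
    apply Finset.sum_eq_zero
    intro u hu
    rw [if_neg]
    intro h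
    exact h0 (key u hu h ▸ hu)

theorem X_last_sub_C_dvd (c : F) (f : MvPolynomial (Fin (n + 1)) F) (h : restr c f = 0) :
    (X (Fin.last n) - C c) ∣ f := by
  have := dvd_sub_map_of_dvd_X ((rename Fin.castSucc).comp (restr c)) (X (Fin.last n) - C c)
    (by
      intro k
      refine Fin.lastCases ?_ (fun k => ?_) k
      · simp [restr, algebraMap_eq]
      · simp [restr]) f
  simpa [h] using this

theorem X_sub_C_ne_zero {σ : Type*} (i : σ) (c : F) : (X i - C c : MvPolynomial σ F) ≠ 0 := by
  intro h
  have := congrArg (eval fun _ => c + 1) h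
  simp at this

theorem totalDegree_X_sub_C {σ : Type*} (i : σ) (c : F) :
    (X i - C c : MvPolynomial σ F).totalDegree = 1 := by
  apply le_antisymm
  · refine (totalDegree_sub _ _).trans (by simp)
  · classical
    have : Finsupp.single i 1 ∈ (X i - C c : MvPolynomial σ F).support := by
      have h0 : (0 : σ →₀ ℕ) ≠ Finsupp.single i 1 := by
        intro h
        simpa using DFunLike.congr_fun h i
      rw [mem_support_iff, coeff_sub, coeff_C, if_neg h0]
      simp
    have := le_totalDegree this
    simpa using this

/-- Mixed unisolvence: every composition imposes either a vanishing condition at its spectral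
vector or, in top degree, a vanishing coefficient. -/
theorem Generic.eq_zero_of_vanish {q t : F} (hg : Generic q t) (n d : ℕ)
    (f : MvPolynomial (Fin n) F) (hd : f.totalDegree ≤ d)
    (hf : ∀ β, sz β ≤ d → eval (spec q t β) f = 0 ∨
      (sz β = d ∧ coeff (Finsupp.equivFunOnFinite.symm β) f = 0)) : f = 0 := by
  induction n generalizing d with
  | zero =>
    rcases hf (fun _ => 0) (by simp) with h | h
    · rw [eq_C_of_isEmpty f] at h ⊢
      simpa using h
    · rw [eq_C_of_isEmpty f]
      have : (Finsupp.equivFunOnFinite.symm fun _ : Fin 0 => 0) = 0 := by ext i; simp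
      rw [← this, h.2, C_0]
  | succ n ihn =>
    induction d generalizing f with
    | zero =>
      -- The compositions ending in `0` have spectral vectors on the hyperplane `x_{n+1} = t^{-n}`,
      -- where they are those of `n` variables; the restriction to it vanishes by induction on the
      -- number of variables.
      have hr : restr (t⁻¹ ^ n) f = 0 := by
        refine ihn 0 _ ((totalDegree_restr_le _ f).trans hd) fun β hβ => ?_
        rcases hf (Fin.snoc β 0) (by rwa [sz_snoc_zero]) with h | h
        · left; rwa [eval_restr, ← spec_snoc_zero]
        · right; rw [sz_snoc_zero] at h
          exact ⟨h.1, by rw [coeff_restr _ _ _ (by omega)]; exact h.2⟩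
      obtain ⟨g, rfl⟩ := X_last_sub_C_dvd _ f hr
      by_contra hne
      rw [totalDegree_mul_of_isDomain (X_sub_C_ne_zero _ _) (right_ne_zero_of_mul hne),
        totalDegree_X_sub_C] at hd
      omega
    | succ d ihd =>
      have hr : restr (t⁻¹ ^ n) f = 0 := by
        refine ihn (d + 1) _ ((totalDegree_restr_le _ f).trans hd) fun β hβ => ?_
        rcases hf (Fin.snoc β 0) (by rwa [sz_snoc_zero]) with h | h
        · left; rwa [eval_restr, ← spec_snoc_zero]
        · right; rw [sz_snoc_zero] at h
          exact ⟨h.1, by rw [coeff_restr _ _ _ (by omega)]; exact h.2⟩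
      obtain ⟨g, rfl⟩ := X_last_sub_C_dvd _ f hr
      have hgd : g.totalDegree ≤ d := totalDegree_le_of_mul_left (X_sub_C_ne_zero _ _)
        (hd.trans (by rw [totalDegree_X_sub_C]; omega))
      -- The remaining compositions are the `raise β`. Since `omInv q g` takes at `β̄` the value of
      -- `g` at the spectral vector of `raise β`, the quotient satisfies the hypotheses in degree
      -- `d`.
      suffices h : omInv q g = 0 by
        rw [← om_omInv hg.q_ne g, h, map_zero, mul_zero]
      refine ihd _ (totalDegree_le_of_isHomogeneous_map (omInv q).toLinearMap
        (isHomogeneous_omInv q) g hgd) fun β hβ => ?_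
      rcases hf (raise β) (by rw [sz_raise]; omega) with h | h
      · left
        rw [map_mul] at h
        rw [eval_omInv, ← spec_raise]
        refine (mul_eq_zero.mp h).resolve_left ?_
        simpa [sub_eq_zero] using raise_last_ne hg β
      · right
        rw [sz_raise] at h
        refine ⟨by omega, ?_⟩
        rw [coeff_omInv q g (Fin.snoc (fun k => β k.succ) (β 0)) β (by simp) (by simp)]
        have h2 := h.2
        have e1 : (Finsupp.equivFunOnFinite.symm (raise β)) =
            Finsupp.equivFunOnFinite.symm (Fin.snoc (fun k => β k.succ) (β 0) : Fin (n + 1) → ℕ) +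
              Finsupp.single (Fin.last n) 1 := by
          ext i
          refine Fin.lastCases ?_ (fun i => ?_) i
          · simp
          · simp
        -- The constant in `x_{n+1} - t^{-n}` contributes nothing in degree `d + 1`, so the
        -- top-degree coefficient condition passes to `g` with its last exponent lowered by one.
        have e2 : coeff (Finsupp.equivFunOnFinite.symm (raise β)) (C (t⁻¹ ^ n) * g) = 0 := by
          rw [coeff_C_mul, coeff_eq_zero_of_totalDegree_lt, mul_zero]
          refine lt_of_le_of_lt hgd ?_
          refine lt_of_lt_of_eq ?_ (degree_symm (raise β)).symm
          rw [sz_raise]; omega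
        rw [sub_mul, coeff_sub, e2, sub_zero, mul_comm (X _), e1, coeff_mul_X] at h2
        rw [h2, mul_zero]

/-- Unisolvence of interpolation at the spectral vectors. -/
theorem Generic.eq_zero {q t : F} (hg : Generic q t) {d : ℕ}
    {f : MvPolynomial (Fin n) F} (hd : f.totalDegree ≤ d)
    (hf : ∀ β, sz β ≤ d → eval (spec q t β) f = 0) : f = 0 :=
  hg.eq_zero_of_vanish n d f hd fun β hβ => Or.inl (hf β hβ)

theorem Generic.exists_interp {q t : F} (hg : Generic q t) (d : ℕ) (c : (Fin n → ℕ) → F) :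
    ∃ f : MvPolynomial (Fin n) F, f.totalDegree ≤ d ∧
      ∀ β, sz β ≤ d → eval (spec q t β) f = c β := by
  refine exists_of_unique d (fun β => (aeval (spec q t β)).toLinearMap) ?_ c
  intro f hd hf
  exact hg.eq_zero hd hf

/-- The square system is solved with the value at `ᾱ` replaced by the coefficient of `x^α`; this is
why unisolvence is proved with mixed conditions. -/
theorem Generic.exists_normalized {q t : F} (hg : Generic q t) (α : Fin n → ℕ) :
    ∃ f : MvPolynomial (Fin n) F, f.totalDegree ≤ sz α ∧
      (∀ β, sz β ≤ sz α → β ≠ α → eval (spec q t β) f = 0) ∧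
      coeff (Finsupp.equivFunOnFinite.symm α) f = 1 := by
  classical
  obtain ⟨f, hd, hf⟩ := exists_of_unique (F := F) (sz α) (fun β => if β = α then
      lcoeff F (Finsupp.equivFunOnFinite.symm α) else (aeval (spec q t β)).toLinearMap) (by
    intro f hd hf
    refine hg.eq_zero_of_vanish n _ f hd fun β hβ => ?_
    have := hf β hβ
    split_ifs at this with h
    · subst h; exact Or.inr ⟨rfl, this⟩
    · exact Or.inl this) (fun β => if β = α then 1 else 0)
  refine ⟨f, hd, fun β hβ hne => ?_, ?_⟩
  · have := hf β hβ
    rw [if_neg hne, if_neg hne] at this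
    exact this
  · have := hf α le_rfl
    rw [if_pos rfl, if_pos rfl] at this
    exact this

theorem Generic.normalized_unique {q t : F} (hg : Generic q t) (α : Fin n → ℕ)
    {f g : MvPolynomial (Fin n) F} (hf : f.totalDegree ≤ sz α) (hgd : g.totalDegree ≤ sz α)
    (h : ∀ β, sz β ≤ sz α → β ≠ α → eval (spec q t β) f = eval (spec q t β) g)
    (hc : coeff (Finsupp.equivFunOnFinite.symm α) f = coeff (Finsupp.equivFunOnFinite.symm α) g) :
    f = g := by
  rw [← sub_eq_zero]
  refine hg.eq_zero_of_vanish n (sz α) _ ((totalDegree_sub _ _).trans (max_le hf hgd)) fun β hβ => ?_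
  by_cases hne : β = α
  · subst hne; right; simp [hc]
  · left; simp [h β hβ hne]

end Omega

/-! ### Demazure–Lusztig operators and divisibility of `f + Z_i f` by `x_i` -/

section Hecke
variable {F : Type*} [Field F] {m : ℕ}

/-- The adjacent transposition of the indices `i` and `i + 1`. -/
abbrev adj (i : Fin m) : Equiv.Perm (Fin (m + 1)) := Equiv.swap i.castSucc i.succ

/-- The exchange of two adjacent variables. -/
def sw (i : Fin m) : MvPolynomial (Fin (m + 1)) F →ₐ[F] MvPolynomial (Fin (m + 1)) F :=
  rename (adj i)

theorem eval_sw (i : Fin m) (x : Fin (m + 1) → F) (f : MvPolynomial (Fin (m + 1)) F) :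
    eval x (sw i f) = eval (x ∘ adj i) f := by
  rw [sw, eval_rename]

theorem X_sub_X_ne_zero {σ : Type*} {i j : σ} (h : i ≠ j) :
    (X i - X j : MvPolynomial σ F) ≠ 0 := by
  classical
  intro h0
  have := congrArg (eval fun k => if k = i then 1 else 0) h0
  simp [h.symm] at this

theorem X_adj_ne (i : Fin m) : (X i.castSucc - X i.succ : MvPolynomial (Fin (m + 1)) F) ≠ 0 :=
  X_sub_X_ne_zero (Fin.castSucc_lt_succ).ne

theorem isHomogeneous_X_adj (i : Fin m) :
    (X i.castSucc - X i.succ : MvPolynomial (Fin (m + 1)) F).IsHomogeneous 1 :=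
  (isHomogeneous_X F _).sub (isHomogeneous_X F _)

theorem exists_dd (i : Fin m) (f : MvPolynomial (Fin (m + 1)) F) :
    ∃ g, (X i.castSucc - X i.succ) * g = f - sw i f := by
  obtain ⟨g, hg⟩ := dvd_sub_map_of_dvd_X (sw i) (X i.castSucc - X i.succ) (fun k => by
    rw [sw, rename_X]
    by_cases h1 : k = i.castSucc
    · subst h1; simp
    · by_cases h2 : k = i.succ
      · subst h2; simp only [Equiv.swap_apply_right]; exact ⟨-1, by ring⟩
      · rw [Equiv.swap_apply_of_ne_of_ne h1 h2, sub_self]; exact dvd_zero _) f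
  exact ⟨g, hg.symm⟩

/-- The divided difference operator. -/
def dd (i : Fin m) : MvPolynomial (Fin (m + 1)) F →ₗ[F] MvPolynomial (Fin (m + 1)) F where
  toFun f := (exists_dd i f).choose
  map_add' f g := by
    apply mul_left_cancel₀ (X_adj_ne i)
    rw [mul_add, (exists_dd i f).choose_spec, (exists_dd i g).choose_spec,
      (exists_dd i (f + g)).choose_spec, map_add]
    ring
  map_smul' c f := by
    apply mul_left_cancel₀ (X_adj_ne i)
    rw [RingHom.id_apply, mul_smul_comm, (exists_dd i f).choose_spec,
      (exists_dd i (c • f)).choose_spec, map_smul, smul_sub]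

theorem dd_spec (i : Fin m) (f : MvPolynomial (Fin (m + 1)) F) :
    (X i.castSucc - X i.succ) * dd i f = f - sw i f := (exists_dd i f).choose_spec

/-- The Demazure–Lusztig operator `T_i`. -/
def T (t : F) (i : Fin m) : Module.End F (MvPolynomial (Fin (m + 1)) F) :=
  t • 1 + LinearMap.mulLeft F (C t * X i.succ - X i.castSucc) ∘ₗ dd i

theorem T_apply (t : F) (i : Fin m) (f : MvPolynomial (Fin (m + 1)) F) :
    T t i f = C t * f + (C t * X i.succ - X i.castSucc) * dd i f := by
  simp [T, smul_eq_C_mul]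

theorem X_adj_mul_T (t : F) (i : Fin m) (f : MvPolynomial (Fin (m + 1)) F) :
    (X i.castSucc - X i.succ) * T t i f = (C t * (X i.castSucc - X i.succ)) * f +
      (C t * X i.succ - X i.castSucc) * (f - sw i f) := by
  rw [T_apply, ← dd_spec]; ring

theorem isHomogeneous_T (t : F) (i : Fin m) (k : ℕ) (f : MvPolynomial (Fin (m + 1)) F)
    (hf : f.IsHomogeneous k) : (T t i f).IsHomogeneous k := by
  apply isHomogeneous_of_mul_left (isHomogeneous_X_adj i) (X_adj_ne i)
  rw [X_adj_mul_T, add_comm k 1]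
  have hC : (C t : MvPolynomial (Fin (m + 1)) F).IsHomogeneous 0 := isHomogeneous_C _ t
  refine IsHomogeneous.add ?_ ?_
  · have := (hC.mul (isHomogeneous_X_adj (F := F) i)).mul hf
    rwa [zero_add] at this
  · refine IsHomogeneous.mul ?_ (hf.sub ?_)
    · refine IsHomogeneous.sub ?_ (isHomogeneous_X F _)
      simpa using hC.mul (isHomogeneous_X F i.succ)
    · exact hf.rename_isHomogeneous

/-- The operator `t T_i⁻¹ = T_i + 1 - t`. -/
def Th (t : F) (i : Fin m) : Module.End F (MvPolynomial (Fin (m + 1)) F) :=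
  T t i + (1 - t) • 1

theorem Th_apply (t : F) (i : Fin m) (f : MvPolynomial (Fin (m + 1)) F) :
    Th t i f = T t i f + (1 - C t) * f := by
  simp [Th, smul_eq_C_mul]

theorem sw_sw (i : Fin m) (f : MvPolynomial (Fin (m + 1)) F) : sw i (sw i f) = f := by
  rw [sw, rename_rename]
  have : (adj i : Fin (m + 1) → _) ∘ adj i = id := by ext k; simp
  rw [this, rename_id]; rfl

theorem sw_X_castSucc (i : Fin m) : sw i (X i.castSucc : MvPolynomial (Fin (m + 1)) F) = X i.succ := by
  simp [sw]

theorem sw_X_succ (i : Fin m) : sw i (X i.succ : MvPolynomial (Fin (m + 1)) F) = X i.castSucc := by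
  simp [sw]

theorem sw_dd (i : Fin m) (f : MvPolynomial (Fin (m + 1)) F) : sw i (dd i f) = dd i f := by
  have h := congrArg (sw i) (dd_spec i f)
  rw [map_mul, map_sub, map_sub, sw_sw, sw_X_castSucc, sw_X_succ] at h
  apply mul_left_cancel₀ (X_adj_ne i)
  rw [dd_spec]
  linear_combination -h

theorem dd_eq_zero {i : Fin m} {f : MvPolynomial (Fin (m + 1)) F} (h : sw i f = f) : dd i f = 0 := by
  apply mul_left_cancel₀ (X_adj_ne i)
  rw [dd_spec, h, sub_self, mul_zero]

theorem T_of_sw {i : Fin m} {f : MvPolynomial (Fin (m + 1)) F} (t : F) (h : sw i f = f) :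
    T t i f = C t * f := by
  rw [T_apply, dd_eq_zero h, mul_zero, add_zero]

/-- `T_i f - t f` is a non-zero linear form times the divided difference of `f`, so the latter must
vanish. -/
theorem sw_of_T {i : Fin m} {f : MvPolynomial (Fin (m + 1)) F} {t : F}
    (h : T t i f = C t * f) : sw i f = f := by
  rw [T_apply, add_eq_left, mul_eq_zero] at h
  have h1 := h.resolve_left (by
    intro h0
    have := congrArg (eval fun k => if k = i.castSucc then 1 else 0) h0
    simp [(Fin.castSucc_lt_succ (i := i)).ne'] at this)
  have := dd_spec i f
  rw [h1, mul_zero] at this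
  exact (sub_eq_zero.mp this.symm).symm

/-- This is the quadratic Hecke relation `(T_i - t)(T_i + 1) = 0`; it follows from `dd i (T t i f) =
-dd i f`. -/
theorem Th_T (t : F) (i : Fin m) (f : MvPolynomial (Fin (m + 1)) F) :
    Th t i (T t i f) = C t * f := by
  have hC : sw i (C t : MvPolynomial (Fin (m + 1)) F) = C t := by simp [sw]
  have h1 : dd i (T t i f) = - dd i f := by
    apply mul_left_cancel₀ (X_adj_ne i)
    rw [dd_spec, T_apply, map_add, map_mul, map_mul, map_sub, map_mul, sw_dd, sw_X_castSucc,
      sw_X_succ, hC]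
    have := dd_spec i f
    linear_combination -(C t) * this
  rw [Th_apply, T_apply, h1, T_apply]
  ring

theorem T_Th (t : F) (i : Fin m) (f : MvPolynomial (Fin (m + 1)) F) :
    T t i (Th t i f) = C t * f := by
  rw [← Th_T t i, Th_apply, Th_apply, map_add, show (1 - C t) * f = (1 - t) • f by
    simp [smul_eq_C_mul], map_smul]
  simp [smul_eq_C_mul]

/-- The cross relation `T_i x_{i+1} = x_i (t T_i⁻¹)`. Iterated, it carries the factor `x_n` of the
raising operator through `T_i ⋯ T_{n-1}` and turns it into `x_i`. -/
theorem T_X_succ_mul (t : F) (i : Fin m) (f : MvPolynomial (Fin (m + 1)) F) :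
    T t i (X i.succ * f) = X i.castSucc * Th t i f := by
  apply mul_left_cancel₀ (X_adj_ne i)
  rw [X_adj_mul_T, Th_apply, map_mul, sw_X_succ]
  linear_combination -(X i.castSucc) * X_adj_mul_T t i f

/-- In this form the correction term carries a factor `x_i`, so on `x_i = 0` the operator is just
`t` times the exchange. -/
theorem T_eq_sw_add (t : F) (i : Fin m) (f : MvPolynomial (Fin (m + 1)) F) :
    T t i f = C t * sw i f + (C t - 1) * (X i.castSucc * dd i f) := by
  rw [T_apply]
  linear_combination -(C t) * (dd_spec i f)

theorem insertNth_comp_adj (i : Fin m) (y : Fin m → F) :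
    (Fin.insertNth i.castSucc 0 y : Fin (m + 1) → F) ∘ adj i = Fin.insertNth i.succ 0 y := by
  rw [Fin.eq_insertNth_iff]
  refine ⟨by simp, ?_⟩
  funext k
  have : adj i (i.succ.succAbove k) = i.castSucc.succAbove k := by
    rw [Equiv.swap_apply_def]
    simp only [Fin.succAbove, Fin.lt_def, Fin.ext_iff]
    split_ifs <;> simp_all <;> omega
  simp only [Fin.removeNth, Function.comp_apply]
  rw [this, Fin.insertNth_apply_succAbove]

theorem eval_T_insertNth (t : F) (i : Fin m) (y : Fin m → F) (f : MvPolynomial (Fin (m + 1)) F) :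
    eval (Fin.insertNth i.castSucc 0 y : Fin (m + 1) → F) (T t i f) =
      t * eval (Fin.insertNth i.succ 0 y : Fin (m + 1) → F) f := by
  rw [T_eq_sw_add, map_add, map_mul, map_mul, map_mul, eval_sw, insertNth_comp_adj]
  simp

/-- `T_1 ⋯ T_{i-1}`. -/
def opA (t : F) (i : Fin (m + 1)) : Module.End F (MvPolynomial (Fin (m + 1)) F) :=
  Fin.induction (motive := fun _ => Module.End F (MvPolynomial (Fin (m + 1)) F)) 1
    (fun i a => a * T t i) i

/-- `T_i ⋯ T_{n-1}`. -/
def opB (t : F) (i : Fin (m + 1)) : Module.End F (MvPolynomial (Fin (m + 1)) F) :=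
  Fin.reverseInduction (motive := fun _ => Module.End F (MvPolynomial (Fin (m + 1)) F)) 1
    (fun i b => T t i * b) i

@[simp] theorem opA_zero (t : F) : opA t (0 : Fin (m + 1)) = 1 := rfl
@[simp] theorem opA_succ (t : F) (i : Fin m) : opA t i.succ = opA t i.castSucc * T t i := by
  simp [opA]
@[simp] theorem opB_last (t : F) : opB t (Fin.last m) = 1 := by simp [opB]
@[simp] theorem opB_castSucc (t : F) (i : Fin m) : opB t i.castSucc = T t i * opB t i.succ := by
  simp [opB]

/-- The affine raising operator. -/
def raiseOp (q t : F) : Module.End F (MvPolynomial (Fin (m + 1)) F) :=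
  LinearMap.mulLeft F (X (Fin.last m) - C (t⁻¹ ^ m)) ∘ₗ (om q).toLinearMap

theorem raiseOp_apply (q t : F) (f : MvPolynomial (Fin (m + 1)) F) :
    raiseOp q t f = (X (Fin.last m) - C (t⁻¹ ^ m)) * om q f := rfl

theorem eval_opA_insertNth (t : F) (i : Fin (m + 1)) (y : Fin m → F)
    (f : MvPolynomial (Fin (m + 1)) F) :
    eval (Fin.insertNth 0 0 y : Fin (m + 1) → F) (opA t i f) =
      t ^ (i : ℕ) * eval (Fin.insertNth i 0 y : Fin (m + 1) → F) f := by
  induction i using Fin.induction generalizing f with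
  | zero => simp
  | succ i ih =>
    rw [opA_succ, Module.End.mul_apply, ih, eval_T_insertNth]
    simp; ring

theorem eval_opB_insertNth (t : F) (i : Fin (m + 1)) (y : Fin m → F)
    (f : MvPolynomial (Fin (m + 1)) F) :
    eval (Fin.insertNth i 0 y : Fin (m + 1) → F) (opB t i f) =
      t ^ (m - i : ℕ) * eval (Fin.insertNth (Fin.last m) 0 y : Fin (m + 1) → F) f := by
  induction i using Fin.reverseInduction generalizing f with
  | last => simp
  | cast i ih =>
    rw [opB_castSucc, Module.End.mul_apply, eval_T_insertNth, ih, ← mul_assoc, ← pow_succ']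
    congr 2
    simp; omega

theorem eval_raiseOp_insertNth (q t : F) (y : Fin m → F)
    (f : MvPolynomial (Fin (m + 1)) F) :
    eval (Fin.insertNth (Fin.last m) 0 y : Fin (m + 1) → F) (raiseOp q t f) =
      - t⁻¹ ^ m * eval (Fin.insertNth 0 0 y : Fin (m + 1) → F) f := by
  rw [raiseOp_apply, map_mul, eval_om]
  simp [Fin.insertNth_last', Fin.insertNth_zero']

/-- `T_i ⋯ T_{n-1} Φ T_1 ⋯ T_{i-1}`. -/
def opZ (q t : F) (i : Fin (m + 1)) : Module.End F (MvPolynomial (Fin (m + 1)) F) :=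
  opB t i * raiseOp q t * opA t i

theorem Generic.infinite {q t : F} (h : Generic q t) : Infinite F := by
  refine Infinite.of_injective (fun k : ℕ => q ^ k) fun a b hab => ?_
  exact (h.eq_of_eq_nat (b := 0) (b' := 0) (by simpa using hab)).1

theorem X_dvd_of_eval [Infinite F] (i : Fin (m + 1)) (f : MvPolynomial (Fin (m + 1)) F)
    (h : ∀ y : Fin m → F, eval (Fin.insertNth i 0 y : Fin (m + 1) → F) f = 0) : X i ∣ f := by
  have h1 := dvd_sub_map_of_dvd_X (aeval (Fin.insertNth i 0 fun k => X (i.succAbove k)))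
    (X i : MvPolynomial (Fin (m + 1)) F) (fun k => by
      refine Fin.succAboveCases i ?_ (fun k => ?_) k <;> simp) f
  have h2 : aeval (Fin.insertNth i 0 fun k => X (i.succAbove k)) f =
      (0 : MvPolynomial (Fin (m + 1)) F) := by
    apply MvPolynomial.funext
    intro x
    rw [eval_aeval_eq, map_zero, ← h (fun k => x (i.succAbove k))]
    congr 2; funext k
    refine Fin.succAboveCases i ?_ (fun k => ?_) k <;> simp
  rwa [h2, sub_zero] at h1

/-- On the hyperplane `x_i = 0` each factor of `Z_i` only moves the zero coordinate and multiplies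
by a scalar. The zero travels once around the cycle, and the total scalar is `-1`. -/
theorem Generic.exists_X_mul_eq {q t : F} (hg : Generic q t) (i : Fin (m + 1))
    (f : MvPolynomial (Fin (m + 1)) F) : ∃ g, f + opZ q t i f = X i * g := by
  have := hg.infinite
  refine X_dvd_of_eval i _ fun y => ?_
  rw [map_add, opZ, Module.End.mul_apply, Module.End.mul_apply, eval_opB_insertNth,
    eval_raiseOp_insertNth, eval_opA_insertNth]
  -- The three powers come from `opB`, from the constant term of the affine factor, and from `opA`.
  have h : t ^ (m - i : ℕ) * (t⁻¹ ^ m * t ^ (i : ℕ)) = 1 := by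
    rw [mul_left_comm, ← pow_add, Nat.sub_add_cancel (by omega), inv_pow,
      inv_mul_cancel₀ (pow_ne_zero _ hg.t_ne)]
  linear_combination -(eval (Fin.insertNth i 0 y : Fin (m + 1) → F) f) * h

end Hecke

/-! ### Exchange of entries, propagation of vanishing, and the operators `Ξ_i` -/

section Swap
variable {F : Type*} [Field F] {m : ℕ} {q t : F}

theorem adj_lt_adj (i : Fin m) (l k : Fin (m + 1)) (h1 : ¬ (l = i.castSucc ∧ k = i.succ))
    (h2 : ¬ (l = i.succ ∧ k = i.castSucc)) : adj i l < adj i k ↔ l < k := by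
  rw [Equiv.swap_apply_def, Equiv.swap_apply_def]
  simp only [Fin.lt_def, Fin.ext_iff, Fin.val_castSucc, Fin.val_succ] at *
  split_ifs <;> simp_all <;> omega

theorem rank_adj {β : Fin (m + 1) → ℕ} {i : Fin m} (h : β i.castSucc ≠ β i.succ)
    (k : Fin (m + 1)) : rank (β ∘ adj i) k = rank β (adj i k) := by
  unfold rank
  rw [← Equiv.sum_comp (adj i) (fun l => if dom β l (adj i k) then 1 else 0)]
  refine Finset.sum_congr rfl fun l _ => ?_
  congr 1
  unfold dom
  simp only [Function.comp_apply, eq_iff_iff]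
  refine or_congr Iff.rfl (and_congr_right fun he => ?_)
  rw [adj_lt_adj]
  · rintro ⟨rfl, rfl⟩; simp at he; exact h he
  · rintro ⟨rfl, rfl⟩; simp at he; exact h he.symm

theorem spec_adj {β : Fin (m + 1) → ℕ} {i : Fin m} (h : β i.castSucc ≠ β i.succ) :
    spec q t (β ∘ adj i) = spec q t β ∘ adj i := by
  funext k
  simp only [spec, rank_adj h, Function.comp_apply]

theorem rank_succ {β : Fin (m + 1) → ℕ} {i : Fin m} (h : β i.castSucc = β i.succ) :
    rank β i.succ = rank β i.castSucc + 1 := by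
  unfold rank
  have h1 : ∑ l, (if l = i.castSucc then 1 else 0) = 1 := by simp
  have h2 (l : Fin (m + 1)) : (if dom β l i.succ then 1 else 0) =
      (if dom β l i.castSucc then 1 else 0) + (if l = i.castSucc then 1 else 0) := by
    unfold dom
    by_cases hl : l = i.castSucc
    · subst hl; simp [h]
    · have : l < i.succ ↔ l < i.castSucc := by
        simp only [Fin.lt_def, Fin.ext_iff, Fin.val_castSucc, Fin.val_succ] at *; omega
      simp [hl, h, this]
  rw [Finset.sum_congr rfl fun l _ => h2 l, Finset.sum_add_distrib, h1]

theorem Generic.spec_castSucc (hg : Generic q t) {β : Fin (m + 1) → ℕ} {i : Fin m}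
    (h : β i.castSucc = β i.succ) :
    spec q t β i.castSucc = t * spec q t β i.succ := by
  simp only [spec, rank_succ h, h, pow_succ]
  have := hg.t_ne
  field_simp

theorem comp_adj_eq {β : Fin (m + 1) → ℕ} {i : Fin m} (h : β i.castSucc = β i.succ) :
    β ∘ adj i = β := by
  funext k
  simp only [Function.comp_apply, Equiv.swap_apply_def]
  split_ifs with h1 h2
  · rw [h1, h]
  · rw [h2, h]
  · rfl

theorem sz_adj (β : Fin (m + 1) → ℕ) (i : Fin m) : sz (β ∘ adj i) = sz β :=
  Equiv.sum_comp (adj i) β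

theorem sum_spec_adj (q t : F) (β : Fin (m + 1) → ℕ) (i : Fin m) :
    ∑ k, spec q t (β ∘ adj i) k = ∑ k, spec q t β k := by
  by_cases h : β i.castSucc = β i.succ
  · rw [comp_adj_eq h]
  · rw [spec_adj h]; exact Equiv.sum_comp (adj i) (spec q t β)

/-- Stability of a set of compositions under adjacent exchanges. -/
def SwapClosed (J : Set (Fin (m + 1) → ℕ)) : Prop := ∀ β ∈ J, ∀ i : Fin m, β ∘ adj i ∈ J

/-- Vanishing at the spectral vectors of a set of compositions. -/
def VanishOn {n : ℕ} (q t : F) (J : Set (Fin n → ℕ)) (f : MvPolynomial (Fin n) F) : Prop :=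
  ∀ β ∈ J, eval (spec q t β) f = 0

theorem eval_T_mul (t : F) (i : Fin m) (x : Fin (m + 1) → F) (f : MvPolynomial (Fin (m + 1)) F) :
    (x i.castSucc - x i.succ) * eval x (T t i f) =
      t * (x i.castSucc - x i.succ) * eval x f +
        (t * x i.succ - x i.castSucc) * (eval x f - eval (x ∘ adj i) f) := by
  have := congrArg (eval x) (X_adj_mul_T t i f)
  simpa [eval_sw] using this

theorem eval_T_of_eq (t : F) (i : Fin m) (x : Fin (m + 1) → F) (h : x i.castSucc = t * x i.succ)
    (f : MvPolynomial (Fin (m + 1)) F) : eval x (T t i f) = t * eval x f := by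
  rw [T_apply]; simp [h]

/-- The value of `T_i f` at `β̄` combines those of `f` at `β̄` and at its exchange. The exchange is
again a spectral vector unless `β_i = β_{i+1}`; but then `x_i = t x_{i+1}` there, and the
coefficient of the divided difference vanishes. -/
theorem Generic.vanishOn_T (hg : Generic q t) {J : Set (Fin (m + 1) → ℕ)} (hJ : SwapClosed J)
    (i : Fin m) {f : MvPolynomial (Fin (m + 1)) F} (hf : VanishOn q t J f) :
    VanishOn q t J (T t i f) := by
  intro β hβ
  by_cases h : β i.castSucc = β i.succ
  · rw [eval_T_of_eq _ _ _ (hg.spec_castSucc h), hf β hβ, mul_zero]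
  · have := eval_T_mul t i (spec q t β) f
    rw [← spec_adj h, hf β hβ, hf _ (hJ β hβ i)] at this
    simp only [mul_zero, sub_zero, add_zero, mul_eq_zero] at this
    refine this.resolve_left fun h0 => h ?_
    exact (hg.spec_eq (sub_eq_zero.mp h0)).1

theorem Generic.vanishOn_opA (hg : Generic q t) {J : Set (Fin (m + 1) → ℕ)} (hJ : SwapClosed J)
    (i : Fin (m + 1)) {f : MvPolynomial (Fin (m + 1)) F} (hf : VanishOn q t J f) :
    VanishOn q t J (opA t i f) := by
  induction i using Fin.induction generalizing f with
  | zero => simpa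
  | succ i ih =>
    rw [opA_succ, Module.End.mul_apply]
    exact ih (hg.vanishOn_T hJ i hf)

theorem Generic.vanishOn_opB (hg : Generic q t) {J : Set (Fin (m + 1) → ℕ)} (hJ : SwapClosed J)
    (i : Fin (m + 1)) {f : MvPolynomial (Fin (m + 1)) F} (hf : VanishOn q t J f) :
    VanishOn q t J (opB t i f) := by
  induction i using Fin.reverseInduction with
  | last => simpa
  | cast i ih =>
    rw [opB_castSucc, Module.End.mul_apply]
    exact hg.vanishOn_T hJ i ih

/-- At compositions with last entry `0` the affine factor vanishes; every other composition is some
`raise β`, where `om q f` takes the value of `f` at `β̄`. -/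
theorem vanishOn_raiseOp (hq : q ≠ 0) {J J' : Set (Fin (m + 1) → ℕ)}
    (hJ : ∀ β, raise β ∈ J → β ∈ J')
    {f : MvPolynomial (Fin (m + 1)) F} (hf : VanishOn q t J' f) :
    VanishOn q t J (raiseOp q t f) := by
  intro β hβ
  rw [raiseOp_apply, map_mul]
  by_cases h0 : β (Fin.last m) = 0
  · have : β = Fin.snoc (fun k => β k.castSucc) 0 := by
      funext k
      refine Fin.lastCases ?_ (fun k => ?_) k <;> simp [h0]
    rw [this, spec_snoc_zero]
    simp
  · obtain ⟨β, rfl⟩ := exists_raise β h0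
    rw [eval_om, spec_raise]
    convert mul_zero _ using 2
    rw [← hf β (hJ β hβ)]
    congr 2
    funext k
    refine Fin.cases ?_ (fun k => ?_) k
    · simp; field_simp
    · simp

theorem Generic.vanishOn_opZ (hg : Generic q t) {J J' : Set (Fin (m + 1) → ℕ)} (hJ : SwapClosed J)
    (hJ' : SwapClosed J') (hr : ∀ β, raise β ∈ J → β ∈ J') (i : Fin (m + 1))
    {f : MvPolynomial (Fin (m + 1)) F} (hf : VanishOn q t J' f) :
    VanishOn q t J (opZ q t i f) := by
  rw [opZ, Module.End.mul_apply, Module.End.mul_apply]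
  exact hg.vanishOn_opB hJ i (vanishOn_raiseOp hg.q_ne hr (hg.vanishOn_opA hJ' i hf))

theorem totalDegree_T_le (i : Fin m) {f : MvPolynomial (Fin (m + 1)) F} {d : ℕ}
    (hf : f.totalDegree ≤ d) : (T t i f).totalDegree ≤ d :=
  totalDegree_le_of_isHomogeneous_map _ (isHomogeneous_T t i) f hf

theorem isHomogeneous_opA (t : F) (i : Fin (m + 1)) (k : ℕ) (f : MvPolynomial (Fin (m + 1)) F)
    (hf : f.IsHomogeneous k) : (opA t i f).IsHomogeneous k := by
  induction i using Fin.induction generalizing f with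
  | zero => simpa
  | succ i ih =>
    rw [opA_succ, Module.End.mul_apply]
    exact ih _ (isHomogeneous_T t i k f hf)

theorem isHomogeneous_opB (t : F) (i : Fin (m + 1)) (k : ℕ) (f : MvPolynomial (Fin (m + 1)) F)
    (hf : f.IsHomogeneous k) : (opB t i f).IsHomogeneous k := by
  induction i using Fin.reverseInduction generalizing f with
  | last => simpa
  | cast i ih =>
    rw [opB_castSucc, Module.End.mul_apply]
    exact isHomogeneous_T t i k _ (ih f hf)

theorem totalDegree_opZ_le (i : Fin (m + 1)) {f : MvPolynomial (Fin (m + 1)) F} {d : ℕ}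
    (hf : f.totalDegree ≤ d) : (opZ q t i f).totalDegree ≤ d + 1 := by
  rw [opZ, Module.End.mul_apply, Module.End.mul_apply]
  refine totalDegree_le_of_isHomogeneous_map _ (isHomogeneous_opB t i) _ ?_
  rw [raiseOp_apply]
  refine (totalDegree_mul _ _).trans ?_
  rw [totalDegree_X_sub_C, add_comm]
  gcongr
  refine totalDegree_le_of_isHomogeneous_map (om q).toLinearMap (isHomogeneous_om q) _ ?_
  exact totalDegree_le_of_isHomogeneous_map _ (isHomogeneous_opA t i) _ hf

/-- The operator `Ξ_i` on a polynomial of degree at most `d` which vanishes in sizes below `d`. -/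
theorem Generic.exists_xi (hg : Generic q t) {d : ℕ} {f : MvPolynomial (Fin (m + 1)) F}
    (hd : f.totalDegree ≤ d) (hf : VanishOn q t {β | sz β < d} f) (i : Fin (m + 1)) :
    ∃ g, f + opZ q t i f = X i * g ∧ g.totalDegree ≤ d ∧
      ∀ β, sz β ≤ d → eval (spec q t β) g = (spec q t β i)⁻¹ * eval (spec q t β) f := by
  obtain ⟨g, hgg⟩ := hg.exists_X_mul_eq i f
  refine ⟨g, hgg, ?_, fun β hβ => ?_⟩
  · refine totalDegree_le_of_mul_left (X_ne_zero (R := F) i) ?_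
    rw [← hgg, totalDegree_X]
    exact (totalDegree_add _ _).trans (max_le (by omega)
      ((totalDegree_opZ_le i hd).trans (by omega)))
  -- `Z_i` contains one raising step, so vanishing in sizes below `d` becomes vanishing up to `d`.
  -- Hence the values of `g` are those of `f / x_i`.
  · have h1 : VanishOn q t {β | sz β ≤ d} (opZ q t i f) := by
      refine hg.vanishOn_opZ ?_ ?_ ?_ i hf
      · intro β hβ i; simpa [sz_adj] using hβ
      · intro β hβ i; simpa [sz_adj] using hβ
      · intro β hβ; simp only [Set.mem_ofPred_eq, sz_raise] at *; omega
    have := congrArg (eval (spec q t β)) hgg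
    rw [map_add, h1 β hβ, add_zero, map_mul, eval_X] at this
    rw [this, inv_mul_cancel_left₀ (spec_ne_zero hg β i)]

end Swap

/-! ### Eigenvalue equations, extra vanishing, and roots on the line through `τ` -/

section Basis
variable {F : Type*} [Field F] {m n : ℕ} {q t : F}

/-- The interpolation polynomial with value one at `α`. -/
def basis (hg : Generic q t) (α : Fin n → ℕ) : MvPolynomial (Fin n) F :=
  (hg.exists_interp (sz α) (Pi.single (M := fun _ => F) α 1)).choose

theorem totalDegree_basis_le (hg : Generic q t) (α : Fin n → ℕ) :
    (basis hg α).totalDegree ≤ sz α :=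
  (hg.exists_interp (sz α) (Pi.single (M := fun _ => F) α 1)).choose_spec.1

theorem eval_basis (hg : Generic q t) {α β : Fin n → ℕ} (h : sz β ≤ sz α) :
    eval (spec q t β) (basis hg α) = Pi.single (M := fun _ => F) α 1 β :=
  (hg.exists_interp (sz α) (Pi.single (M := fun _ => F) α 1)).choose_spec.2 β h

theorem eval_basis_self (hg : Generic q t) (α : Fin n → ℕ) :
    eval (spec q t α) (basis hg α) = 1 := by
  rw [eval_basis hg le_rfl, Pi.single_eq_same]

theorem eval_basis_ne (hg : Generic q t) {α β : Fin n → ℕ} (h : sz β ≤ sz α) (hne : β ≠ α) :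
    eval (spec q t β) (basis hg α) = 0 := by
  rw [eval_basis hg h, Pi.single_eq_of_ne hne]

theorem vanishOn_basis (hg : Generic q t) (α : Fin n → ℕ) :
    VanishOn q t {β | sz β < sz α} (basis hg α) := fun _ hβ =>
  eval_basis_ne hg (le_of_lt hβ) (by rintro rfl; exact lt_irrefl _ (Set.mem_ofPred_eq ▸ hβ))

/-- `Ξ_i` multiplies the value at each `β̄` by `β̄_i⁻¹`. The basis polynomial has only one non-zero
value in sizes up to its degree, so unisolvence makes it an eigenvector. -/
theorem opZ_basis (hg : Generic q t) (α : Fin (m + 1) → ℕ) (i : Fin (m + 1)) :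
    basis hg α + opZ q t i (basis hg α) = X i * (C (spec q t α i)⁻¹ * basis hg α) := by
  obtain ⟨g, h1, h2, h3⟩ := hg.exists_xi (totalDegree_basis_le hg α) (vanishOn_basis hg α) i
  rw [h1]
  congr 1
  rw [← sub_eq_zero]
  refine hg.eq_zero (d := sz α) ((totalDegree_sub _ _).trans (max_le h2 ?_)) fun β hβ => ?_
  · exact (totalDegree_mul _ _).trans (by simpa using totalDegree_basis_le hg α)
  · rw [map_sub, h3 β hβ, map_mul, eval_C]
    by_cases h : β = α
    · subst h; ring
    · rw [eval_basis_ne hg hβ h]; ring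

/-- Induction on the size of `β ∈ I`: if all smaller elements of `I` are zeros, then `Z_i` of the
polynomial vanishes at `β̄`, and the eigenvalue equation leaves `(1 - β̄_i / ᾱ_i) G_α(β̄) = 0`. Some
`i` has `β_i ≠ α_i` because `α ∉ I`. -/
theorem eval_basis_extra (hg : Generic q t) {I : Set (Fin (m + 1) → ℕ)} (hI : SwapClosed I)
    (hr : ∀ β, raise β ∈ I → β ∈ I) {α : Fin (m + 1) → ℕ} (hα : α ∉ I) :
    VanishOn q t I (basis hg α) := by
  have key (d : ℕ) : VanishOn q t {β | β ∈ I ∧ sz β < d} (basis hg α) := by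
    induction d with
    | zero => intro β hβ; simp at hβ
    | succ d ih =>
      intro β hβ
      obtain ⟨i, hi⟩ : ∃ i, α i ≠ β i := by
        by_contra! h
        exact hα (funext h ▸ hβ.1)
      have h1 : VanishOn q t {β | β ∈ I ∧ sz β < d + 1} (opZ q t i (basis hg α)) := by
        refine hg.vanishOn_opZ ?_ ?_ ?_ i ih
        · intro β hβ i; exact ⟨hI β hβ.1 i, by rw [sz_adj]; exact hβ.2⟩
        · intro β hβ i; exact ⟨hI β hβ.1 i, by rw [sz_adj]; exact hβ.2⟩
        · intro β hβ
          have h2 := hβ.2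
          rw [sz_raise] at h2
          exact ⟨hr β hβ.1, by omega⟩
      have h2 := congrArg (eval (spec q t β)) (opZ_basis hg α i)
      rw [map_add, h1 β hβ, add_zero, map_mul, map_mul, eval_X, eval_C, ← mul_assoc] at h2
      by_contra h0
      have h3 : spec q t β i * (spec q t α i)⁻¹ = 1 := (mul_eq_right₀ h0).mp h2.symm
      rw [mul_inv_eq_one₀ (spec_ne_zero hg _ _)] at h3
      exact hi (hg.spec_eq h3).1.symm
  exact fun β hβ => key (sz β + 1) β ⟨hβ, Nat.lt_succ_self _⟩

/-- The number of entries exceeding `j`. -/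
def cnt (α : Fin n → ℕ) (j : ℕ) : ℕ := ∑ k, if j < α k then 1 else 0

theorem cnt_adj (α : Fin (m + 1) → ℕ) (i : Fin m) (j : ℕ) : cnt (α ∘ adj i) j = cnt α j :=
  Equiv.sum_comp (adj i) (fun k => if j < α k then 1 else 0)

theorem cnt_le_cnt_raise (α : Fin (m + 1) → ℕ) (j : ℕ) : cnt α j ≤ cnt (raise α) j := by
  unfold cnt
  rw [Fin.sum_univ_castSucc (fun k => if j < raise α k then 1 else 0),
    Fin.sum_univ_succ (fun k => if j < α k then 1 else 0), add_comm]
  simp only [raise_castSucc, raise_last]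
  refine Nat.add_le_add_left ?_ _
  split_ifs <;> omega

/-- The set of `γ` with at most `cnt β j` entries above `j` is closed under exchanges and under
undoing `raise`, contains `β` and misses `α`. -/
theorem eval_basis_of_cnt_lt (hg : Generic q t) {α β : Fin n → ℕ} {j : ℕ}
    (h : cnt β j < cnt α j) : eval (spec q t β) (basis hg α) = 0 := by
  cases n with
  | zero => simp [cnt] at h
  | succ m =>
    refine eval_basis_extra hg (I := {γ | cnt γ j ≤ cnt β j}) ?_ ?_ ?_ β (Nat.le_refl _)
    · intro γ hγ i; simpa [cnt_adj] using hγ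
    · intro γ hγ; exact (cnt_le_cnt_raise γ j).trans hγ
    · simpa using h

theorem totalDegree_aeval_le {σ ρ : Type*} (g : σ → MvPolynomial ρ F)
    (hg : ∀ i, (g i).totalDegree ≤ 1) (f : MvPolynomial σ F) :
    (aeval g f).totalDegree ≤ f.totalDegree := by
  conv_lhs => rw [f.as_sum, map_sum]
  refine totalDegree_finsetSum_le fun u hu => ?_
  refine le_trans ?_ (le_totalDegree hu)
  rw [aeval_monomial]
  refine (totalDegree_mul _ _).trans ?_
  rw [algebraMap_eq, totalDegree_C, zero_add]
  refine (totalDegree_finsetProd _ _).trans (Finset.sum_le_sum fun i _ => ?_)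
  refine (totalDegree_pow _ _).trans ?_
  simpa using Nat.mul_le_mul_left (u i) (hg i)

theorem cnt_append {n i : ℕ} (b : Fin n → ℕ) (c : Fin i → ℕ) (j : ℕ) :
    cnt (Fin.append b c) j = cnt b j + cnt c j := by
  unfold cnt
  rw [Fin.sum_univ_add]
  simp only [Fin.append_left, Fin.append_right]

theorem rank_const (n j : ℕ) (k : Fin n) : rank (fun _ : Fin n => j) k = k := by
  simp only [rank, dom, lt_irrefl, false_or, true_and]
  rw [← Finset.card_filter]
  rw [show Finset.univ.filter (fun i => i < k) = Finset.Iio k by ext; simp, Fin.card_Iio]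

theorem dom_append_left {n i : ℕ} (b : Fin n → ℕ) (c : Fin i → ℕ) (k l : Fin n) :
    dom (Fin.append b c) (Fin.castAdd i k) (Fin.castAdd i l) ↔ dom b k l := by
  simp only [dom, Fin.append_left, Fin.lt_def, Fin.val_castAdd]

theorem dom_append_right {n i : ℕ} (b : Fin n → ℕ) (c : Fin i → ℕ) (k l : Fin i) :
    dom (Fin.append b c) (Fin.natAdd n k) (Fin.natAdd n l) ↔ dom c k l := by
  simp only [dom, Fin.append_right, Fin.lt_def, Fin.val_natAdd, add_lt_add_iff_left]

theorem spec_append_of_le {n i : ℕ} (b : Fin n → ℕ) (c : Fin i → ℕ) (h : ∀ k l, c l ≤ b k) :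
    spec q t (Fin.append b c) = Fin.append (spec q t b) fun l => t⁻¹ ^ n * spec q t c l := by
  funext k
  refine Fin.addCases (fun k => ?_) (fun l => ?_) k
  · have : rank (Fin.append b c) (Fin.castAdd i k) = rank b k := by
      unfold rank
      rw [Fin.sum_univ_add]
      have h1 (l : Fin i) : ¬ dom (Fin.append b c) (Fin.natAdd n l) (Fin.castAdd i k) := by
        have := h k l
        simp only [dom, Fin.append_left, Fin.append_right, Fin.lt_def, Fin.val_natAdd,
          Fin.val_castAdd]
        omega
      simp [h1, dom_append_left]
    simp [spec, this]
  · have : rank (Fin.append b c) (Fin.natAdd n l) = n + rank c l := by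
      unfold rank
      rw [Fin.sum_univ_add]
      have h1 (k : Fin n) : dom (Fin.append b c) (Fin.castAdd i k) (Fin.natAdd n l) := by
        have := h k l
        simp only [dom, Fin.append_left, Fin.append_right, Fin.lt_def, Fin.val_natAdd,
          Fin.val_castAdd]
        omega
      simp [h1, dom_append_right]
    simp [spec, this, pow_add]; ring

theorem spec_append_of_lt {n i : ℕ} (b : Fin n → ℕ) (c : Fin i → ℕ) (h : ∀ k l, b k < c l) :
    spec q t (Fin.append b c) = Fin.append (fun k => t⁻¹ ^ i * spec q t b k) (spec q t c) := by
  funext k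
  refine Fin.addCases (fun k => ?_) (fun l => ?_) k
  · have : rank (Fin.append b c) (Fin.castAdd i k) = i + rank b k := by
      unfold rank
      rw [Fin.sum_univ_add]
      have h1 (l : Fin i) : dom (Fin.append b c) (Fin.natAdd n l) (Fin.castAdd i k) := by
        have := h k l
        simp only [dom, Fin.append_left, Fin.append_right]
        omega
      simp [h1, dom_append_left, add_comm]
    simp [spec, this, pow_add]; ring
  · have : rank (Fin.append b c) (Fin.natAdd n l) = rank c l := by
      unfold rank
      rw [Fin.sum_univ_add]
      have h1 (k : Fin n) : ¬ dom (Fin.append b c) (Fin.castAdd i k) (Fin.natAdd n l) := by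
        have := h k l
        simp only [dom, Fin.append_left, Fin.append_right]
        omega
      simp [h1, dom_append_right]
    simp [spec, this]

/-- Stability of the interpolation polynomials under adding zero entries. -/
theorem eval_basis_append (hg : Generic q t) (α : Fin n → ℕ) (i : ℕ) (x : Fin n → F) :
    eval (Fin.append x fun l : Fin i => t⁻¹ ^ n * t⁻¹ ^ (l : ℕ))
      (basis hg (Fin.append α fun _ : Fin i => 0)) = eval x (basis hg α) := by
  have hsz (β : Fin n → ℕ) : sz (Fin.append β fun _ : Fin i => 0) = sz β := by
    simp [sz, Fin.sum_univ_add]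
  have hev (x : Fin n → F) : eval (Fin.append x fun l : Fin i => t⁻¹ ^ n * t⁻¹ ^ (l : ℕ))
      (basis hg (Fin.append α fun _ : Fin i => 0)) =
      eval x (aeval (Fin.append X fun l : Fin i => C (t⁻¹ ^ n * t⁻¹ ^ (l : ℕ)))
        (basis hg (Fin.append α fun _ : Fin i => 0))) := by
    rw [eval_aeval_eq]
    congr 2; funext k
    refine Fin.addCases (fun k => ?_) (fun k => ?_) k <;> simp
  rw [hev]
  congr 1
  rw [← sub_eq_zero]
  refine hg.eq_zero (d := sz α) ((totalDegree_sub _ _).trans (max_le ?_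
    (totalDegree_basis_le hg α))) fun β hβ => ?_
  · refine (totalDegree_aeval_le _ (fun k => ?_) _).trans ((totalDegree_basis_le hg _).trans
      (hsz α).le)
    refine Fin.addCases (fun k => ?_) (fun k => ?_) k
    · simp
    · rw [Fin.append_right, totalDegree_C]; exact Nat.zero_le _
  · rw [map_sub, ← hev]
    have : (Fin.append (spec q t β) fun l : Fin i => t⁻¹ ^ n * t⁻¹ ^ (l : ℕ)) =
        spec q t (Fin.append β fun _ : Fin i => 0) := by
      rw [spec_append_of_le _ _ (by simp)]
      simp [spec, rank_const]
    rw [this, sub_eq_zero]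
    by_cases h : β = α
    · subst h; rw [eval_basis_self, eval_basis_self]
    · rw [eval_basis_ne hg hβ h, eval_basis_ne hg (by rwa [hsz, hsz])]
      intro he
      apply h
      funext k
      simpa using congrFun he (Fin.castAdd i k)

/-- The roots of the interpolation polynomials along the line through `τ`. -/
theorem eval_basis_root (hg : Generic q t) (α : Fin n → ℕ) {i j : ℕ} (h : i < cnt α j) :
    eval (fun k : Fin n => q ^ j * t⁻¹ ^ i * t⁻¹ ^ (k : ℕ)) (basis hg α) = 0 := by
  rw [← eval_basis_append hg α i]
  set f := basis hg (Fin.append α fun _ : Fin i => 0)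
  -- The last `i` coordinates `t^{-n}, t^{-n-1}, …` are replaced by `y, y t⁻¹, …` with `y` free; the
  -- value sought is at `y = t^{-n}`.
  let p : Polynomial F := aeval (Fin.append
    (fun k : Fin n => Polynomial.C (q ^ j * t⁻¹ ^ i * t⁻¹ ^ (k : ℕ)))
    (fun l : Fin i => Polynomial.X * Polynomial.C (t⁻¹ ^ (l : ℕ)))) f
  have hp (y : F) : p.eval y = eval (Fin.append (fun k : Fin n => q ^ j * t⁻¹ ^ i * t⁻¹ ^ (k : ℕ))
      (fun l : Fin i => y * t⁻¹ ^ (l : ℕ))) f := by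
    rw [← Polynomial.coe_aeval_eq_eval, ← AlgHom.coe_toRingHom]
    change (Polynomial.aeval y) (aeval _ f) = _
    rw [comp_aeval_apply, aeval_eq_eval]
    congr 2; funext k
    refine Fin.addCases (fun k => ?_) (fun k => ?_) k
    · simp
    · simp; ring
  suffices h0 : p = 0 by
    rw [← hp, h0, Polynomial.eval_zero]
  -- At `y = q^M` the point is the spectral vector of `(j^n, M^i)`, which has only `i < cnt α j`
  -- entries above `j`. The `M^i` come first in rank, hence the factor `t^{-i}` on the other
  -- coordinates.
  have hroot (M : ℕ) (hM : j < M) : p.IsRoot (q ^ M) := by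
    rw [Polynomial.IsRoot, hp]
    rw [← eval_basis_of_cnt_lt hg (α := Fin.append α fun _ : Fin i => 0)
      (β := Fin.append (fun _ : Fin n => j) fun _ : Fin i => M) (j := j)]
    · rw [spec_append_of_lt _ _ (fun _ _ => hM)]
      congr 2
      congr 1
      · funext k; simp only [spec, rank_const]; ring
      · funext k; simp only [spec, rank_const]
    · rw [cnt_append, cnt_append]
      simpa [cnt, hM] using h
  apply Polynomial.eq_zero_of_infinite_isRoot
  refine Set.Infinite.mono (s := Set.range fun M : ℕ => q ^ (j + 1 + M)) ?_ ?_
  · rintro _ ⟨M, rfl⟩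
    exact hroot _ (by omega)
  · refine Set.infinite_range_of_injective fun a b hab => ?_
    have := (hg.eq_of_eq_nat (b := 0) (b' := 0) (by simpa using hab)).1
    omega

theorem sum_cnt (α : Fin n → ℕ) {D : ℕ} (hD : ∀ k, α k ≤ D) :
    ∑ j ∈ Finset.range D, cnt α j = sz α := by
  unfold cnt
  rw [Finset.sum_comm]
  refine Finset.sum_congr rfl fun k _ => ?_
  rw [← Finset.card_filter]
  have : (Finset.range D).filter (fun j => j < α k) = Finset.range (α k) := by
    ext j; have := hD k; simp; omega
  rw [this, Finset.card_range]

theorem aeval_mul_of_isHomogeneous {A : Type*} [CommRing A] [Algebra F A] {k : ℕ}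
    {g : MvPolynomial (Fin n) F} (hg : g.IsHomogeneous k) (y : A) (z : Fin n → A) :
    aeval (fun i => y * z i) g = y ^ k * aeval z g := by
  rw [g.as_sum, map_sum, map_sum, Finset.mul_sum]
  refine Finset.sum_congr rfl fun u hu => ?_
  have h1 : u.degree = k := by
    rw [Finsupp.degree_eq_weight_one]
    exact hg (mem_support_iff.mp hu)
  rw [Finsupp.degree_eq_sum] at h1
  rw [aeval_monomial, aeval_monomial, Finsupp.prod_fintype _ _ (by simp),
    Finsupp.prod_fintype _ _ (by simp)]
  simp only [mul_pow]
  rw [Finset.prod_mul_distrib, Finset.prod_pow_eq_pow_sum, h1]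
  ring

/-- Factorization of the restriction to the line through `τ`. -/
theorem aeval_tau_eq (hg : Generic q t) {K : Type*} [Field K] [Algebra F K] (α : Fin n → ℕ)
    {f : MvPolynomial (Fin n) F} (hd : f.totalDegree ≤ sz α)
    (hf : ∀ i j, i < cnt α j → eval (fun k : Fin n => q ^ j * t⁻¹ ^ i * t⁻¹ ^ (k : ℕ)) f = 0)
    (c : K) :
    aeval (fun k : Fin n => c * algebraMap F K (t⁻¹ ^ (k : ℕ))) f =
      algebraMap F K
          (eval (fun k : Fin n => t⁻¹ ^ (k : ℕ)) (homogeneousComponent (sz α) f)) *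
        ∏ j ∈ Finset.range (sz α), ∏ i ∈ Finset.range (cnt α j),
          (c - algebraMap F K (q ^ j * t⁻¹ ^ i)) := by
  set τ : Fin n → F := fun k => t⁻¹ ^ (k : ℕ)
  set d := sz α
  let p : Polynomial F := aeval (fun k : Fin n => Polynomial.X * Polynomial.C (τ k)) f
  have hp : p = ∑ k ∈ Finset.range (d + 1),
      Polynomial.C (eval τ (homogeneousComponent k f)) * Polynomial.X ^ k := by
    have h1 : f = ∑ k ∈ Finset.range (d + 1), homogeneousComponent k f := by
      conv_lhs => rw [← sum_homogeneousComponent f]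
      refine Finset.sum_subset (Finset.range_subset_range.mpr (by omega)) fun k _ hk => ?_
      exact homogeneousComponent_eq_zero _ _ (by simpa using hk)
    have h2 : p = aeval (fun k : Fin n => Polynomial.X * Polynomial.C (τ k))
      (∑ k ∈ Finset.range (d + 1), homogeneousComponent k f) := by rw [← h1]
    rw [h2, map_sum]
    refine Finset.sum_congr rfl fun k _ => ?_
    rw [aeval_mul_of_isHomogeneous (homogeneousComponent_isHomogeneous k f), mul_comm]
    congr 1
    have := comp_aeval_apply (R := F) (f := τ) (Algebra.ofId F (Polynomial F))
      (homogeneousComponent k f)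
    rw [aeval_eq_eval] at this
    exact this.symm
  let v : (_ : ℕ) × ℕ → F := fun s => q ^ s.1 * t⁻¹ ^ s.2
  let s : Finset ((_ : ℕ) × ℕ) := (Finset.range d).sigma fun j => Finset.range (cnt α j)
  let r : Polynomial F := ∏ x ∈ s, (Polynomial.X - Polynomial.C (v x))
  have hcard : s.card = d := by
    rw [Finset.card_sigma]
    simp only [Finset.card_range]
    exact sum_cnt α fun k => Finset.single_le_sum (f := α) (fun _ _ => Nat.zero_le _)
      (Finset.mem_univ k)
  have hrm : r.Monic := Polynomial.monic_prod_of_monic _ _ fun x _ => Polynomial.monic_X_sub_C _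
  have hrd : r.natDegree = d := by
    rw [← hcard]; exact Polynomial.natDegree_finsetProd_X_sub_C_eq_card _ _
  -- The `d` points are distinct by genericity, both sides vanish at them, and the coefficients of
  -- degree `d` agree.
  have hpr : p = Polynomial.C (eval τ (homogeneousComponent d f)) * r := by
    refine Polynomial.eq_of_degree_sub_lt_of_eval_index_eq (v := v) s ?_ ?_ ?_
    · rintro ⟨j, i⟩ _ ⟨j', i'⟩ _ h
      obtain ⟨h1, h2⟩ := hg.eq_of_eq_nat h
      simp only at h1 h2
      subst h1 h2; rfl
    · rw [hcard, Polynomial.degree_lt_iff_coeff_zero]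
      intro k hk
      rw [Polynomial.coeff_sub, Polynomial.coeff_C_mul, hp, Polynomial.finsetSum_coeff]
      simp only [Polynomial.coeff_C_mul_X_pow]
      rcases eq_or_lt_of_le hk with h | h
      · subst h
        rw [Finset.sum_ite_eq, if_pos (by simp)]
        have := hrm.coeff_natDegree
        rw [hrd] at this
        rw [this]; ring
      · rw [Finset.sum_ite_eq, if_neg (by simp; omega),
          Polynomial.coeff_eq_zero_of_natDegree_lt (hrd.symm ▸ h)]
        ring
    · rintro ⟨j, i⟩ hs
      have h1 : r.eval (v ⟨j, i⟩) = 0 := by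
        rw [Polynomial.eval_prod]
        exact Finset.prod_eq_zero hs (by simp)
      have h2 : p.eval (v ⟨j, i⟩) = 0 := by
        rw [← hf i j (by simpa [s] using (Finset.mem_sigma.mp hs).2), ← Polynomial.coe_aeval_eq_eval,
          ← AlgHom.coe_toRingHom]
        change (Polynomial.aeval _) (aeval _ f) = _
        rw [comp_aeval_apply, aeval_eq_eval]
        congr 2; funext k
        simp [v, τ]; ring
      rw [h2, Polynomial.eval_mul, h1, mul_zero]
  have h1 : Polynomial.aeval c p = aeval (fun k : Fin n => c * algebraMap F K (τ k)) f := by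
    rw [comp_aeval_apply]
    congr 2; funext k
    simp; ring
  rw [← h1, hpr, map_mul, Polynomial.aeval_C, map_prod, Finset.prod_sigma]
  simp [v]

end Basis

/-! ### Cherednik operators on leading forms and inversion of the parameters -/

section Top
variable {F : Type*} [Field F] {m : ℕ} {q t : F}

theorem Th_T_smul (t : F) (i : Fin m) (f : MvPolynomial (Fin (m + 1)) F) :
    Th t i (T t i f) = t • f := by rw [Th_T, smul_eq_C_mul]

theorem T_Th_smul (t : F) (i : Fin m) (f : MvPolynomial (Fin (m + 1)) F) :
    T t i (Th t i f) = t • f := by rw [T_Th, smul_eq_C_mul]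

/-- The iterated application `L_{k-1} ⋯ L_0 g`. -/
def iter (L : Fin m → Module.End F (MvPolynomial (Fin (m + 1)) F))
    (g : MvPolynomial (Fin (m + 1)) F) : ℕ → MvPolynomial (Fin (m + 1)) F
  | 0 => g
  | k + 1 => if h : k < m then L ⟨k, h⟩ (iter L g k) else 0

theorem iter_succ (L : Fin m → Module.End F (MvPolynomial (Fin (m + 1)) F))
    (g : MvPolynomial (Fin (m + 1)) F) (i : Fin m) :
    iter L g (i + 1 : ℕ) = L i (iter L g i) := by
  simp [iter]

theorem iter_smul (L : Fin m → Module.End F (MvPolynomial (Fin (m + 1)) F))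
    (g : MvPolynomial (Fin (m + 1)) F) (c : F) (k : ℕ) : iter L (c • g) k = c • iter L g k := by
  induction k with
  | zero => rfl
  | succ k ih => simp only [iter]; split_ifs <;> simp [ih]

theorem iter_add (L : Fin m → Module.End F (MvPolynomial (Fin (m + 1)) F))
    (g h : MvPolynomial (Fin (m + 1)) F) (k : ℕ) :
    iter L (g + h) k = iter L g k + iter L h k := by
  induction k with
  | zero => rfl
  | succ k ih => simp only [iter]; split_ifs <;> simp [ih]

/-- `t^{n-i} T_i⁻¹ ⋯ T_{n-1}⁻¹`. -/
def opU (t : F) (i : Fin (m + 1)) : Module.End F (MvPolynomial (Fin (m + 1)) F) :=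
  Fin.reverseInduction (motive := fun _ => Module.End F (MvPolynomial (Fin (m + 1)) F)) 1
    (fun i b => Th t i * b) i

/-- `T_{n-1} ⋯ T_i`. -/
def opBr (t : F) (i : Fin (m + 1)) : Module.End F (MvPolynomial (Fin (m + 1)) F) :=
  Fin.reverseInduction (motive := fun _ => Module.End F (MvPolynomial (Fin (m + 1)) F)) 1
    (fun i b => b * T t i) i

@[simp] theorem opU_last (t : F) : opU t (Fin.last m) = 1 := by simp [opU]
@[simp] theorem opU_castSucc (t : F) (i : Fin m) : opU t i.castSucc = Th t i * opU t i.succ := by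
  simp [opU]
@[simp] theorem opBr_last (t : F) : opBr t (Fin.last m) = 1 := by simp [opBr]
@[simp] theorem opBr_castSucc (t : F) (i : Fin m) :
    opBr t i.castSucc = opBr t i.succ * T t i := by
  simp [opBr]

theorem opB_X_last_mul (t : F) (i : Fin (m + 1)) (h : MvPolynomial (Fin (m + 1)) F) :
    opB t i (X (Fin.last m) * h) = X i * opU t i h := by
  induction i using Fin.reverseInduction with
  | last => simp
  | cast i ih =>
    rw [opB_castSucc, opU_castSucc, Module.End.mul_apply, Module.End.mul_apply, ih, T_X_succ_mul]

theorem opBr_opU (t : F) (i : Fin (m + 1)) (h : MvPolynomial (Fin (m + 1)) F) :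
    opBr t i (opU t i h) = t ^ (m - i : ℕ) • h := by
  induction i using Fin.reverseInduction with
  | last => simp
  | cast i ih =>
    rw [opBr_castSucc, opU_castSucc, Module.End.mul_apply, Module.End.mul_apply, T_Th_smul,
      map_smul, ih, smul_smul, ← pow_succ']
    congr 2
    simp; omega

theorem iter_opA (t : F) (i : Fin (m + 1)) (h : MvPolynomial (Fin (m + 1)) F) :
    iter (Th t) (opA t i h) i = t ^ (i : ℕ) • h := by
  induction i using Fin.induction generalizing h with
  | zero => simp [iter]
  | succ i ih =>
    rw [opA_succ, Module.End.mul_apply, Fin.val_succ, iter_succ]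
    rw [Fin.val_castSucc] at ih
    rw [ih, map_smul, Th_T_smul, smul_smul, pow_succ]

/-- The operator `U_i ω T_1 ⋯ T_{i-1}`, the leading part of `Ξ_i`. -/
def opY (q t : F) (i : Fin (m + 1)) : Module.End F (MvPolynomial (Fin (m + 1)) F) :=
  opU t i * (om q).toLinearMap * opA t i

theorem opY_apply (q t : F) (i : Fin (m + 1)) (f : MvPolynomial (Fin (m + 1)) F) :
    opY q t i f = opU t i (om q (opA t i f)) := rfl

/-- Only the `x_n` of the affine factor reaches degree `d + 1`; the cross relation then brings it to
the front as `x_i`. -/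
theorem homogeneousComponent_opZ {f : MvPolynomial (Fin (m + 1)) F} {d : ℕ}
    (hd : f.totalDegree ≤ d) (i : Fin (m + 1)) :
    homogeneousComponent (d + 1) (opZ q t i f) =
      X i * opY q t i (homogeneousComponent d f) := by
  have hA := totalDegree_le_of_isHomogeneous_map _ (isHomogeneous_opA t i) _ hd
  have hom : (om q (opA t i f)).totalDegree ≤ d :=
    totalDegree_le_of_isHomogeneous_map (om q).toLinearMap (isHomogeneous_om q) _ hA
  have h1 := homogeneousComponent_map (opB t i) 0 (isHomogeneous_opB t i)
    (raiseOp q t (opA t i f)) (d + 1)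
  have h2 := homogeneousComponent_map (om q).toLinearMap 0 (isHomogeneous_om q) (opA t i f) d
  have h3 := homogeneousComponent_map (opA t i) 0 (isHomogeneous_opA t i) f d
  rw [add_zero] at h1 h2 h3
  rw [opZ, Module.End.mul_apply, Module.End.mul_apply, h1, raiseOp_apply, sub_mul, map_sub,
    homogeneousComponent_C_mul, homogeneousComponent_mul_left (isHomogeneous_X F _),
    homogeneousComponent_eq_zero (d + 1) _ (Nat.lt_succ_of_le hom), mul_zero, sub_zero]
  change opB t i (X _ * homogeneousComponent d ((om q).toLinearMap (opA t i f))) = _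
  rw [h2, h3, opB_X_last_mul]
  rfl

/-- The leading part of the basis polynomial. -/
def lead {n : ℕ} (hg : Generic q t) (α : Fin n → ℕ) : MvPolynomial (Fin n) F :=
  homogeneousComponent (sz α) (basis hg α)

theorem homogeneousComponent_xi {f g : MvPolynomial (Fin (m + 1)) F} {d : ℕ}
    (hd : f.totalDegree ≤ d) {i : Fin (m + 1)} (h : f + opZ q t i f = X i * g) :
    homogeneousComponent d g = opY q t i (homogeneousComponent d f) := by
  apply mul_left_cancel₀ (X_ne_zero (R := F) i)
  rw [← homogeneousComponent_opZ hd, ← homogeneousComponent_mul_left (isHomogeneous_X F i), ← h,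
    map_add, homogeneousComponent_eq_zero _ f (by omega), zero_add]

/-- The top component of the eigenvalue equation, with `x_i` cancelled. -/
theorem opY_lead (hg : Generic q t) (α : Fin (m + 1) → ℕ) (i : Fin (m + 1)) :
    opY q t i (lead hg α) = (spec q t α i)⁻¹ • lead hg α := by
  rw [lead, ← homogeneousComponent_xi (totalDegree_basis_le hg α) (opZ_basis hg α i),
    homogeneousComponent_C_mul, smul_eq_C_mul]

/-- `Th_{i-1} ⋯ Th_1 ω⁻¹ T_{n-1} ⋯ T_i`, proportional to the inverse of `opY`. -/
def opK (q t : F) (i : Fin (m + 1)) (f : MvPolynomial (Fin (m + 1)) F) :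
    MvPolynomial (Fin (m + 1)) F := iter (Th t) (omInv q (opBr t i f)) i

theorem opK_smul (c : F) (i : Fin (m + 1)) (f : MvPolynomial (Fin (m + 1)) F) :
    opK q t i (c • f) = c • opK q t i f := by
  rw [opK, map_smul, map_smul, iter_smul, opK]

theorem opK_add (i : Fin (m + 1)) (f g : MvPolynomial (Fin (m + 1)) F) :
    opK q t i (f + g) = opK q t i f + opK q t i g := by
  rw [opK, map_add, map_add, iter_add, opK, opK]

/-- `opK` as a linear map. -/
def opKL (q t : F) (i : Fin (m + 1)) : Module.End F (MvPolynomial (Fin (m + 1)) F) where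
  toFun := opK q t i
  map_add' := opK_add i
  map_smul' c f := opK_smul c i f

theorem opK_opY (hg : Generic q t) (i : Fin (m + 1)) (f : MvPolynomial (Fin (m + 1)) F) :
    opKL q t i (opY q t i f) = t ^ m • f := by
  change opK q t i _ = _
  rw [opK, opY_apply, opBr_opU, map_smul, omInv_om hg.q_ne, iter_smul, iter_opA, smul_smul,
    ← pow_add]
  congr 2; omega

theorem opK_lead (hg : Generic q t) (α : Fin (m + 1) → ℕ) (i : Fin (m + 1)) :
    opKL q t i (lead hg α) = (t ^ m * spec q t α i) • lead hg α := by
  have h := opK_opY hg i (lead hg α)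
  rw [opY_lead, map_smul] at h
  rw [mul_comm, mul_smul, ← h, smul_inv_smul₀ (spec_ne_zero hg α i)]

theorem adj_comm {i j : Fin m} (h : (i : ℕ) + 1 < j) (k : Fin (m + 1)) :
    adj i (adj j k) = adj j (adj i k) := by
  have : (adj i).Disjoint (adj j) := by
    apply Equiv.Perm.disjoint_swap_swap
    simp [Fin.ext_iff]
    omega
  exact DFunLike.congr_fun this.commute k

theorem sw_T_comm {i j : Fin m} (h : (i : ℕ) + 1 < j) (t : F) (f : MvPolynomial (Fin (m + 1)) F) :
    sw j (T t i f) = T t i (sw j f) := by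
  have h1 : adj j i.castSucc = i.castSucc := Equiv.swap_apply_of_ne_of_ne
    (by simp only [ne_eq, Fin.ext_iff, Fin.val_castSucc]; omega)
    (by simp only [ne_eq, Fin.ext_iff, Fin.val_castSucc, Fin.val_succ]; omega)
  have h2 : adj j i.succ = i.succ := Equiv.swap_apply_of_ne_of_ne
    (by simp only [ne_eq, Fin.ext_iff, Fin.val_castSucc, Fin.val_succ]; omega)
    (by simp only [ne_eq, Fin.ext_iff, Fin.val_succ]; omega)
  have h3 : sw j (X i.castSucc : MvPolynomial (Fin (m + 1)) F) = X i.castSucc := by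
    rw [sw, rename_X, h1]
  have h4 : sw j (X i.succ : MvPolynomial (Fin (m + 1)) F) = X i.succ := by
    rw [sw, rename_X, h2]
  have hC : sw j (C t : MvPolynomial (Fin (m + 1)) F) = C t := by simp [sw]
  have h5 : sw j (sw i f) = sw i (sw j f) := by
    rw [sw, sw, rename_rename, rename_rename]
    congr 2; funext k
    exact (adj_comm h k).symm
  have := congrArg (sw j) (X_adj_mul_T t i f)
  simp only [map_mul, map_add, map_sub, h3, h4, hC, h5] at this
  apply mul_left_cancel₀ (X_adj_ne i)
  rw [this, X_adj_mul_T]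

theorem sw_iter_T (t : F) {g : MvPolynomial (Fin (m + 1)) F}
    (hgs : ∀ j : Fin m, 0 < (j : ℕ) → sw j g = g) (k : ℕ) (j : Fin m) (h : k < j) :
    sw j (iter (T t) g k) = iter (T t) g k := by
  induction k with
  | zero => exact hgs j h
  | succ k ih =>
    have hk : k < m := by omega
    simp only [iter, hk, dif_pos]
    rw [sw_T_comm (by simpa using h), ih (by omega)]

/-- Induction with `Th = T + 1 - t`. The earlier terms `iter (T t) g j`, `j < k`, are symmetric in
the next pair of variables, so `T` acts on them by `t` and `Th` by `1`. -/
theorem iter_Th_eq (t : F) {g : MvPolynomial (Fin (m + 1)) F}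
    (hgs : ∀ j : Fin m, 0 < (j : ℕ) → sw j g = g) (k : ℕ) (hk : k ≤ m) :
    iter (Th t) g k = iter (T t) g k + (1 - t) • ∑ j ∈ Finset.range k, iter (T t) g j := by
  induction k with
  | zero => simp [iter]
  | succ k ih =>
    have hk' : k < m := by omega
    rw [show iter (Th t) g (k + 1) = Th t ⟨k, hk'⟩ (iter (Th t) g k) from iter_succ _ _ ⟨k, hk'⟩,
      show iter (T t) g (k + 1) = T t ⟨k, hk'⟩ (iter (T t) g k) from iter_succ _ _ ⟨k, hk'⟩,
      ih (by omega), map_add, map_smul, map_sum, Finset.sum_range_succ, Th_apply]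
    have (j : ℕ) (hj : j ∈ Finset.range k) :
        Th t ⟨k, hk'⟩ (iter (T t) g j) = iter (T t) g j := by
      rw [Th_apply, T_of_sw t (sw_iter_T t hgs j ⟨k, hk'⟩ (by simpa using hj))]
      ring
    rw [Finset.sum_congr rfl this, smul_eq_C_mul, smul_eq_C_mul, C_sub, C_1]
    ring

theorem sum_iter_Th (hg : Generic q t) {g : MvPolynomial (Fin (m + 1)) F}
    (hgs : ∀ j : Fin m, 0 < (j : ℕ) → sw j g = g) (k : ℕ) (hk : k ≤ m) :
    ∑ j ∈ Finset.range (k + 1), t⁻¹ ^ j • iter (Th t) g j =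
      t⁻¹ ^ k • ∑ j ∈ Finset.range (k + 1), iter (T t) g j := by
  induction k with
  | zero => simp [iter]
  | succ k ih =>
    rw [Finset.sum_range_succ, ih (by omega), iter_Th_eq t hgs _ hk, Finset.sum_range_succ _ (k + 1)]
    have : t⁻¹ ^ k = t⁻¹ ^ (k + 1) * t := by rw [pow_succ, inv_mul_cancel_right₀ hg.t_ne]
    rw [this]
    module

theorem opA_of_sw (t : F) {P : MvPolynomial (Fin (m + 1)) F} (hP : ∀ j : Fin m, sw j P = P)
    (i : Fin (m + 1)) : opA t i P = t ^ (i : ℕ) • P := by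
  induction i using Fin.induction with
  | zero => simp
  | succ i ih =>
    rw [opA_succ, Module.End.mul_apply, T_of_sw t (hP i), ← smul_eq_C_mul, map_smul, ih, smul_smul,
      Fin.val_succ, pow_succ', Fin.val_castSucc]

theorem opBr_of_sw (t : F) {P : MvPolynomial (Fin (m + 1)) F} (hP : ∀ j : Fin m, sw j P = P)
    (i : Fin (m + 1)) : opBr t i P = t ^ (m - i : ℕ) • P := by
  induction i using Fin.reverseInduction with
  | last => simp
  | cast i ih =>
    rw [opBr_castSucc, Module.End.mul_apply, T_of_sw t (hP i), ← smul_eq_C_mul, map_smul, ih,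
      smul_smul, ← pow_succ']
    congr 2
    simp; omega

/-- Reversal of the variables. -/
def rv {n : ℕ} : MvPolynomial (Fin n) F →ₐ[F] MvPolynomial (Fin n) F := rename Fin.rev

theorem rv_rv {n : ℕ} (f : MvPolynomial (Fin n) F) : rv (rv f) = f := by
  rw [rv, rename_rename, show (Fin.rev ∘ Fin.rev : Fin n → Fin n) = id by ext; simp, rename_id]
  rfl

theorem rv_sw (i : Fin m) (f : MvPolynomial (Fin (m + 1)) F) : rv (sw i f) = sw i.rev (rv f) := by
  rw [sw, sw, rv, rename_rename, rename_rename]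
  congr 2; funext k
  have : adj i.rev = Equiv.swap (Fin.rev i.castSucc) (Fin.rev i.succ) := by
    rw [Fin.rev_castSucc, Fin.rev_succ, Equiv.swap_comm]
  simp only [Function.comp_apply, this]
  have := Equiv.swap_apply_apply Fin.revPerm i.castSucc i.succ
  simp only [Fin.revPerm_apply] at this
  rw [this]
  simp

/-- Reversal inverts `t`: on the reversed variables the operator becomes the inverse of `T` with
parameter `t⁻¹`. -/
theorem rv_T (ht : t ≠ 0) (i : Fin m) (f : MvPolynomial (Fin (m + 1)) F) :
    rv (T t i f) = t • Th t⁻¹ i.rev (rv f) := by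
  have h1 := congrArg rv (X_adj_mul_T t i f)
  have hX1 : rv (X i.castSucc : MvPolynomial (Fin (m + 1)) F) = X i.rev.succ := by
    rw [rv, rename_X, Fin.rev_castSucc]
  have hX2 : rv (X i.succ : MvPolynomial (Fin (m + 1)) F) = X i.rev.castSucc := by
    rw [rv, rename_X, Fin.rev_succ]
  have hC : rv (C t : MvPolynomial (Fin (m + 1)) F) = C t := by simp [rv]
  simp only [map_mul, map_add, map_sub, hX1, hX2, hC, rv_sw] at h1
  have h2 := X_adj_mul_T t⁻¹ i.rev (rv f)
  have h3 : (C t * C t⁻¹ : MvPolynomial (Fin (m + 1)) F) = 1 := by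
    rw [← C_mul, mul_inv_cancel₀ ht, C_1]
  apply mul_left_cancel₀ (X_adj_ne i.rev)
  rw [smul_eq_C_mul, Th_apply]
  linear_combination -h1 - C t * h2 -
    X i.rev.succ * (rv f - sw i.rev (rv f)) * h3

theorem rv_omInv (q : F) (f : MvPolynomial (Fin (m + 1)) F) :
    rv (omInv q f) = om q⁻¹ (rv f) := by
  have : (rv (F := F)).comp (omInv q) = (om q⁻¹).comp (rv (n := m + 1)) := by
    apply algHom_ext
    intro k
    refine Fin.lastCases ?_ (fun k => ?_) k
    · simp [rv]
    · simp [rv, Fin.rev_castSucc, Fin.rev_succ]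
  exact congrArg (fun ψ => ψ f) this

theorem rv_om (q : F) (f : MvPolynomial (Fin (m + 1)) F) :
    rv (om q⁻¹ f) = omInv q (rv f) := by
  have := rv_omInv q (rv f)
  rw [rv_rv] at this
  rw [← this, rv_rv]

theorem rv_opU (ht : t ≠ 0) (i : Fin (m + 1)) (f : MvPolynomial (Fin (m + 1)) F) :
    rv (opU t⁻¹ i f) = t⁻¹ ^ (i.rev : ℕ) • iter (T t) (rv f) i.rev := by
  induction i using Fin.reverseInduction with
  | last => simp [iter]
  | cast i ih =>
    have h1 := rv_T ht i.rev (rv (opU t⁻¹ i.succ f))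
    rw [Fin.rev_rev, rv_rv] at h1
    have h2 : rv (Th t⁻¹ i (opU t⁻¹ i.succ f)) =
        t⁻¹ • T t i.rev (rv (opU t⁻¹ i.succ f)) := by
      rw [← rv_rv (T t i.rev _), h1, map_smul, smul_smul, inv_mul_cancel₀ ht, one_smul]
    rw [opU_castSucc, Module.End.mul_apply, h2, ih, map_smul, smul_smul, ← pow_succ',
      Fin.rev_castSucc, Fin.rev_succ, Fin.val_succ, Fin.val_castSucc, iter_succ]

theorem rename_perm_of_sw {P : MvPolynomial (Fin (m + 1)) F} (hP : ∀ j : Fin m, sw j P = P)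
    (σ : Equiv.Perm (Fin (m + 1))) : rename σ P = P := by
  have hσ : σ ∈ Submonoid.closure (Set.range fun i : Fin m => Equiv.swap i.castSucc i.succ) := by
    rw [Equiv.Perm.mclosure_swap_castSucc_succ]; trivial
  induction hσ using Submonoid.closure_induction with
  | mem x hx => obtain ⟨i, rfl⟩ := hx; exact hP i
  | one => simp
  | mul x y _ _ hx hy => rw [Equiv.Perm.coe_mul, ← rename_rename, hy, hx]

theorem rv_of_sw {P : MvPolynomial (Fin (m + 1)) F} (hP : ∀ j : Fin m, sw j P = P) : rv P = P :=
  rename_perm_of_sw hP Fin.revPerm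

/-- The shift moves every variable but one by a single place, so it conjugates the exchange of index
`j - 1` into that of index `j`. Only the pairs touching `x_1` lose their symmetry. -/
theorem sw_omInv_of_sw (q : F) {P : MvPolynomial (Fin (m + 1)) F} (hP : ∀ j : Fin m, sw j P = P)
    (j : Fin m) (hj : 0 < (j : ℕ)) : sw j (omInv q P) = omInv q P := by
  obtain ⟨i, hi⟩ : ∃ i : Fin m, (i : ℕ) + 1 = j := ⟨⟨j - 1, by omega⟩, by simp; omega⟩
  have hc : i.succ = j.castSucc := by ext; simp [hi]
  have key : (sw j).comp (omInv q) = (omInv q).comp (sw (F := F) i) := by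
    apply algHom_ext
    intro k
    simp only [AlgHom.comp_apply]
    refine Fin.lastCases ?_ (fun k => ?_) k
    · have h1 : adj j 0 = 0 := Equiv.swap_apply_of_ne_of_ne
        (by simp only [ne_eq, Fin.ext_iff, Fin.val_castSucc, Fin.val_zero]; omega)
        (by simp [Fin.ext_iff])
      have h2 : adj i (Fin.last m) = Fin.last m := Equiv.swap_apply_of_ne_of_ne
        (by simp only [ne_eq, Fin.ext_iff, Fin.val_castSucc, Fin.val_last]; omega)
        (by simp only [ne_eq, Fin.ext_iff, Fin.val_succ, Fin.val_last]; omega)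
      rw [omInv_X_last, sw, sw, rename_X, h2, omInv_X_last, map_mul, rename_X, h1, rename_C]
    · have h3 : ∃ l : Fin m, adj i k.castSucc = l.castSucc ∧ adj j k.succ = l.succ := by
        simp only [Equiv.swap_apply_def, Fin.ext_iff, Fin.val_castSucc, Fin.val_succ]
        split_ifs <;> first | omega | skip
        · exact ⟨j, by simp; omega, by simp⟩
        · exact ⟨i, by simp, by simp; omega⟩
        · exact ⟨k, rfl, rfl⟩
      obtain ⟨l, h1, h2⟩ := h3
      rw [omInv_X_castSucc, sw, sw, rename_X, rename_X, h1, h2, omInv_X_castSucc]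
  have := congrArg (fun ψ => ψ P) key
  simp only [AlgHom.comp_apply, hP i] at this
  exact this

/-- The sums of the two families of Cherednik operators agree on symmetric polynomials. -/
theorem sum_opY_inv (hg : Generic q t) {P : MvPolynomial (Fin (m + 1)) F}
    (hP : ∀ j : Fin m, sw j P = P) {e : F} (he : ∑ i, opKL q t i P = (t ^ m * e) • P) :
    ∑ i, opY q⁻¹ t⁻¹ i P = e • P := by
  have ht := hg.t_ne
  set g := omInv q P with hgdef
  have h1 (i : Fin (m + 1)) : opKL q t i P = t ^ m • (t⁻¹ ^ (i : ℕ) • iter (Th t) g i) := by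
    change opK q t i P = _
    rw [opK, opBr_of_sw t hP, map_smul, iter_smul, smul_smul]
    congr 1
    rw [inv_pow, ← div_eq_mul_inv, eq_div_iff (pow_ne_zero _ ht), ← pow_add]
    congr 1; omega
  -- On symmetric `P` the operators for `q, t` give words in `Th` applied to `g`, and by `h3` those
  -- for inverted parameters give, after reversal, words in `T`. `sum_iter_Th` equates the two sums
  -- up to powers of `t`.
  have h2 : ∑ i : Fin (m + 1), iter (T t) g i = (t ^ m * e) • P := by
    rw [Finset.sum_congr rfl fun i _ => h1 i, ← Finset.smul_sum,
      Fin.sum_univ_eq_sum_range (fun i => t⁻¹ ^ i • iter (Th t) g i),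
      sum_iter_Th hg (sw_omInv_of_sw q hP) m le_rfl, smul_smul, inv_pow,
      mul_inv_cancel₀ (pow_ne_zero _ ht), one_smul] at he
    rw [← he, Fin.sum_univ_eq_sum_range (fun i => iter (T t) g i)]
  rw [← rv_rv (∑ i, opY q⁻¹ t⁻¹ i P), map_sum]
  have h3 (i : Fin (m + 1)) : rv (opY q⁻¹ t⁻¹ i P) = t⁻¹ ^ m • iter (T t) g (i.rev : ℕ) := by
    rw [opY_apply, rv_opU ht, rv_om, opA_of_sw _ hP, map_smul, rv_of_sw hP, map_smul, iter_smul,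
      smul_smul, ← pow_add]
    congr 2
    rw [Fin.val_rev]; omega
  have h4 := Equiv.sum_comp Fin.revPerm (fun i : Fin (m + 1) => iter (T t) g (i : ℕ))
  simp only [Fin.revPerm_apply] at h4
  rw [Finset.sum_congr rfl fun i _ => h3 i, ← Finset.smul_sum, h4, h2, smul_smul, inv_pow,
    inv_mul_cancel_left₀ (pow_ne_zero _ ht), map_smul, rv_of_sw hP]

end Top

/-! ### Lifts of leading forms and transfer to inverted parameters -/

section Lift
variable {F : Type*} [Field F] {m n : ℕ} {q t : F}

theorem Generic.eq_of_homogeneousComponent_eq (hg : Generic q t) {d : ℕ}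
    {f g : MvPolynomial (Fin n) F} (hf : f.totalDegree ≤ d) (hgd : g.totalDegree ≤ d)
    (h : homogeneousComponent d f = homogeneousComponent d g)
    (he : ∀ β, sz β < d → eval (spec q t β) f = eval (spec q t β) g) : f = g := by
  rw [← sub_eq_zero]
  have hd : (f - g).totalDegree ≤ d := (totalDegree_sub _ _).trans (max_le hf hgd)
  have h0 : homogeneousComponent d (f - g) = 0 := by rw [map_sub, h, sub_self]
  cases d with
  | zero =>
    rw [← h0, homogeneousComponent_zero]
    exact totalDegree_eq_zero_iff_eq_C.mp (Nat.le_zero.mp hd)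
  | succ d =>
    refine hg.eq_zero (totalDegree_lt_of_homogeneousComponent_eq_zero hd h0) fun β hβ => ?_
    rw [map_sub, he β (by omega), sub_self]

/-- Subtracting the lower-degree interpolant of the values of `p` does not affect the top component.
-/
theorem Generic.exists_lift (hg : Generic q t) {d : ℕ} {p : MvPolynomial (Fin n) F}
    (hp : p.IsHomogeneous d) : ∃ f : MvPolynomial (Fin n) F, f.totalDegree ≤ d ∧
      homogeneousComponent d f = p ∧ VanishOn q t {β | sz β < d} f := by
  have hpp : homogeneousComponent d p = p := by rw [homogeneousComponent_of_mem hp, if_pos rfl]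
  cases d with
  | zero => exact ⟨p, hp.totalDegree_le, hpp, fun β hβ => by simp at hβ⟩
  | succ d =>
    obtain ⟨f, hf, he⟩ := hg.exists_interp d (fun β => eval (spec q t β) p)
    refine ⟨p - f, (totalDegree_sub _ _).trans (max_le hp.totalDegree_le (by omega)), ?_, ?_⟩
    · rw [map_sub, hpp, homogeneousComponent_eq_zero _ f (by omega), sub_zero]
    · intro β hβ
      rw [map_sub, he β (Nat.lt_succ_iff.mp hβ), sub_self]

/-- The span of the leading parts of the basis polynomials indexed by `O`, described through the
vanishing outside `O` of a lift. -/
def leadSpan (q t : F) (d : ℕ) (O : Set (Fin n → ℕ)) : Submodule F (MvPolynomial (Fin n) F) where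
  carrier := {p | ∃ f : MvPolynomial (Fin n) F, f.totalDegree ≤ d ∧
    VanishOn q t {β | sz β ≤ d ∧ β ∉ O} f ∧ homogeneousComponent d f = p}
  zero_mem' := ⟨0, by simp, fun β _ => map_zero _, map_zero _⟩
  add_mem' := by
    rintro _ _ ⟨f, h1, h2, rfl⟩ ⟨g, h3, h4, rfl⟩
    exact ⟨f + g, (totalDegree_add _ _).trans (max_le h1 h3),
      fun β hβ => by rw [map_add, h2 β hβ, h4 β hβ, add_zero], map_add _ _ _⟩
  smul_mem' := by
    rintro c _ ⟨f, h1, h2, rfl⟩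
    exact ⟨c • f, (totalDegree_smul_le _ _).trans h1,
      fun β hβ => by rw [smul_eq_C_mul, map_mul, h2 β hβ, mul_zero], map_smul _ _ _⟩

theorem lead_mem_leadSpan (hg : Generic q t) {d : ℕ} {O : Set (Fin n → ℕ)} {β : Fin n → ℕ}
    (hβ : β ∈ O) (hd : sz β = d) : lead hg β ∈ leadSpan q t d O := by
  subst hd
  refine ⟨basis hg β, totalDegree_basis_le hg β, fun γ hγ => eval_basis_ne hg hγ.1 ?_, rfl⟩
  rintro rfl
  exact hγ.2 hβ

theorem finite_of_sz_eq {d : ℕ} {O : Set (Fin n → ℕ)} (hO : ∀ β ∈ O, sz β = d) : O.Finite :=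
  (finite_sz_le n d).subset fun β hβ => (hO β hβ).le

theorem eq_sum_basis (hg : Generic q t) {d : ℕ} {O : Set (Fin n → ℕ)} (hO : ∀ β ∈ O, sz β = d)
    {f : MvPolynomial (Fin n) F} (hd : f.totalDegree ≤ d)
    (hf : VanishOn q t {β | sz β ≤ d ∧ β ∉ O} f) :
    f = ∑ β ∈ (finite_of_sz_eq hO).toFinset, eval (spec q t β) f • basis hg β := by
  rw [← sub_eq_zero]
  refine hg.eq_zero (d := d) ((totalDegree_sub _ _).trans (max_le hd ?_)) fun γ hγ => ?_
  · refine totalDegree_finsetSum_le fun β hβ => (totalDegree_smul_le _ _).trans ?_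
    rw [← hO β (by simpa using hβ)]
    exact totalDegree_basis_le hg β
  · rw [map_sub, map_sum, sub_eq_zero]
    simp only [smul_eval]
    have h0 (β) (hβ : β ∈ (finite_of_sz_eq hO).toFinset) (hne : β ≠ γ) :
        eval (spec q t β) f * eval (spec q t γ) (basis hg β) = 0 := by
      rw [eval_basis_ne hg _ hne.symm, mul_zero]
      rw [hO β (by simpa using hβ)]; exact hγ
    by_cases h : γ ∈ O
    · rw [Finset.sum_eq_single_of_mem γ (by simpa using h) (fun β hβ hne => h0 β hβ hne),
        eval_basis_self, mul_one]
    · rw [hf γ ⟨hγ, h⟩, Finset.sum_eq_zero]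
      intro β hβ
      refine h0 β hβ ?_
      rintro rfl
      exact h (by simpa using hβ)

theorem T_mem_leadSpan (hg : Generic q t) {d : ℕ} {O : Set (Fin (m + 1) → ℕ)} (hO : SwapClosed O)
    (i : Fin m) {p : MvPolynomial (Fin (m + 1)) F} (hp : p ∈ leadSpan q t d O) :
    T t i p ∈ leadSpan q t d O := by
  obtain ⟨f, h1, h2, rfl⟩ := hp
  refine ⟨T t i f, totalDegree_T_le i h1, hg.vanishOn_T ?_ i h2,
    homogeneousComponent_map (T t i) 0 (isHomogeneous_T t i) f d⟩
  rintro β ⟨hβ, hβO⟩ j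
  refine ⟨by rwa [sz_adj], fun h => hβO ?_⟩
  have := hO _ h j
  rwa [Function.comp_assoc, show (adj j : Fin (m + 1) → _) ∘ adj j = id by ext; simp,
    Function.comp_id] at this

theorem Th_mem_of_T_mem {S : Submodule F (MvPolynomial (Fin (m + 1)) F)} {i : Fin m}
    {p : MvPolynomial (Fin (m + 1)) F} (hp : p ∈ S) (h : T t i p ∈ S) : Th t i p ∈ S := by
  have : Th t i p = T t i p + (1 - t) • p := by simp [Th]
  rw [this]
  exact S.add_mem h (S.smul_mem _ hp)

theorem opBr_mem {S : Submodule F (MvPolynomial (Fin (m + 1)) F)}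
    (hS : ∀ p ∈ S, ∀ i : Fin m, T t i p ∈ S) (i : Fin (m + 1))
    {p : MvPolynomial (Fin (m + 1)) F} (hp : p ∈ S) : opBr t i p ∈ S := by
  induction i using Fin.reverseInduction generalizing p with
  | last => simpa
  | cast i ih =>
    rw [opBr_castSucc, Module.End.mul_apply]
    exact ih (hS p hp i)

theorem iter_Th_mem {S : Submodule F (MvPolynomial (Fin (m + 1)) F)}
    (hS : ∀ p ∈ S, ∀ i : Fin m, T t i p ∈ S) (k : ℕ)
    {p : MvPolynomial (Fin (m + 1)) F} (hp : p ∈ S) : iter (Th t) p k ∈ S := by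
  induction k with
  | zero => exact hp
  | succ k ih =>
    simp only [iter]
    split_ifs with h
    · exact Th_mem_of_T_mem ih (hS _ ih _)
    · exact S.zero_mem

/-- For the first index the eigenvalue equation reads `U ω(lead β) = β̄_1⁻¹ lead β`. Inverting `U`
writes `ω(lead β)` as a multiple of a word in the `T_i` applied to `lead β`, and the span is stable
under these. -/
theorem om_mem_leadSpan (hg : Generic q t) {d : ℕ} {O : Set (Fin (m + 1) → ℕ)} (hO : SwapClosed O)
    (hOd : ∀ β ∈ O, sz β = d) {p : MvPolynomial (Fin (m + 1)) F} (hp : p ∈ leadSpan q t d O) :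
    om q p ∈ leadSpan q t d O := by
  obtain ⟨f, h1, h2, rfl⟩ := hp
  rw [eq_sum_basis hg hOd h1 h2, map_sum, map_sum]
  refine Submodule.sum_mem _ fun β hβ => ?_
  have hβ : β ∈ O := by simpa using hβ
  rw [map_smul, map_smul]
  refine Submodule.smul_mem _ _ ?_
  have h3 : homogeneousComponent d (basis hg β) = lead hg β := by rw [lead, hOd β hβ]
  have h4 := opY_lead hg β 0
  rw [opY_apply, opA_zero, Module.End.one_apply] at h4
  have h5 := congrArg (opBr t 0) h4
  rw [opBr_opU, map_smul] at h5
  have h6 : om q (lead hg β) = (t ^ (m - (0 : Fin (m + 1)) : ℕ))⁻¹ •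
      (spec q t β 0)⁻¹ • opBr t 0 (lead hg β) := by
    rw [← h5, inv_smul_smul₀ (pow_ne_zero _ hg.t_ne)]
  rw [h3, h6]
  refine Submodule.smul_mem _ _ (Submodule.smul_mem _ _ (opBr_mem ?_ _ ?_))
  · exact fun p hp i => T_mem_leadSpan hg hO i hp
  · exact lead_mem_leadSpan hg hβ (hOd β hβ)

/-- A submodule stable under operators contains the joint eigencomponents of its elements. -/
theorem mem_of_sum_mem {M ι κ : Type*} [AddCommGroup M] [Module F M] (S : Submodule F M)
    (Y : ι → Module.End F M) (hS : ∀ i, ∀ p ∈ S, Y i p ∈ S) (v : κ → M) (χ : κ → ι → F)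
    (hv : ∀ k i, Y i (v k) = χ k i • v k) (hχ : Function.Injective χ) (s : Finset κ) (k₀ : κ)
    (hk₀ : k₀ ∈ s) (c : κ → F) (hc : c k₀ ≠ 0) (h : ∑ k ∈ s, c k • v k ∈ S) : v k₀ ∈ S := by
  classical
  induction hn : s.card generalizing s c with
  | zero => rw [Finset.card_eq_zero] at hn; simp [hn] at hk₀
  | succ N ih =>
    by_cases hs : ∃ k ∈ s, k ≠ k₀
    · obtain ⟨k₁, hk₁, hne⟩ := hs
      obtain ⟨i, hi⟩ : ∃ i, χ k₀ i ≠ χ k₁ i := by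
        by_contra! hh
        exact hne (hχ (funext hh)).symm
      -- Applying `Y_i - χ_{k₁}(i)` kills the `k₁` term and rescales the coefficient at `k₀` by a
      -- non-zero factor.
      refine ih (s.erase k₁) (Finset.mem_erase.mpr ⟨hne.symm, hk₀⟩)
        (fun k => c k * (χ k i - χ k₁ i)) (mul_ne_zero hc (sub_ne_zero.mpr hi)) ?_
        (by rw [Finset.card_erase_of_mem hk₁, hn]; rfl)
      have h1 := S.sub_mem (hS i _ h) (S.smul_mem (χ k₁ i) h)
      rw [map_sum, Finset.smul_sum, ← Finset.sum_sub_distrib] at h1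
      rw [← Finset.add_sum_erase _ _ hk₁] at h1
      convert h1 using 1
      rw [map_smul, hv, smul_comm, sub_self, zero_add]
      refine Finset.sum_congr rfl fun k _ => ?_
      rw [map_smul, hv]
      module
    · push Not at hs
      have : s = {k₀} := Finset.eq_singleton_iff_unique_mem.mpr ⟨hk₀, hs⟩
      rw [this, Finset.sum_singleton] at h
      exact (S.smul_mem_iff hc).mp h

/-- The compositions with the size and the spectral sum of `α`. -/
def orb (q t : F) (α : Fin n → ℕ) : Set (Fin n → ℕ) :=
  {β | sz β = sz α ∧ ∑ k, spec q t β k = ∑ k, spec q t α k}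

theorem swapClosed_orb (q t : F) (α : Fin (m + 1) → ℕ) : SwapClosed (orb q t α) := by
  rintro β ⟨h1, h2⟩ i
  exact ⟨by rw [sz_adj, h1], by rw [sum_spec_adj, h2]⟩

/-- The leading part of the symmetric interpolation polynomial is in the span of the leading parts
of the interpolation polynomials with inverted parameters. -/
theorem mem_leadSpan_inv (hg : Generic q t) (α : Fin (m + 1) → ℕ)
    {P : MvPolynomial (Fin (m + 1)) F} (hP : ∀ j : Fin m, sw j P = P)
    (hPd : P.IsHomogeneous (sz α))
    (he : ∑ i, opKL q t i P = (t ^ m * ∑ k, spec q t α k) • P) :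
    P ∈ leadSpan q⁻¹ t⁻¹ (sz α) (orb q t α) := by
  have hi := hg.inv
  obtain ⟨f, hd, htop, hv⟩ := hi.exists_lift hPd
  choose g hg1 hg2 hg3 using fun i => hi.exists_xi hd hv i
  -- The lift `f` is an eigenvector of `∑ Ξ_i` for inverted parameters: top components agree by
  -- `sum_opY_inv`, and both sides vanish in smaller sizes.
  have h1 : ∑ i, g i = C (∑ k, spec q t α k) * f := by
    refine hi.eq_of_homogeneousComponent_eq (d := sz α)
      (totalDegree_finsetSum_le fun i _ => hg2 i)
      ((totalDegree_mul _ _).trans (by rw [totalDegree_C, zero_add]; exact hd)) ?_ ?_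
    · rw [map_sum, homogeneousComponent_C_mul, htop, ← smul_eq_C_mul, ← sum_opY_inv hg hP he]
      refine Finset.sum_congr rfl fun i _ => ?_
      rw [homogeneousComponent_xi hd (hg1 i), htop]
    · intro β hβ
      rw [map_sum, map_mul, hv β hβ, mul_zero]
      refine Finset.sum_eq_zero fun i _ => ?_
      rw [hg3 i β hβ.le, hv β hβ, mul_zero]
  refine ⟨f, hd, ?_, htop⟩
  rintro β ⟨hβ, hβO⟩
  rcases hβ.lt_or_eq with hlt | heq
  · exact hv β hlt
  -- In size `d` the sum of the `Ξ_i` multiplies the value by the sum of the inverse spectral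
  -- entries for `q⁻¹, t⁻¹`, which is the spectral sum of `β` for `q, t`. A non-zero value thus
  -- forces `β` into the orbit.
  · have h2 := congrArg (eval (spec q⁻¹ t⁻¹ β)) h1
    rw [map_sum, map_mul, eval_C, Finset.sum_congr rfl fun i _ => hg3 i β hβ, ← Finset.sum_mul] at h2
    by_contra h0
    refine hβO ⟨heq, ?_⟩
    rw [← mul_right_cancel₀ h0 h2]
    refine Finset.sum_congr rfl fun i _ => ?_
    simp only [spec, mul_inv, inv_pow, inv_inv]

/-- Passing through the symmetric sum `P` is essential: the operators for the two parameter choices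
are related only on symmetric polynomials. Once `P` is in the span, stability and distinct joint
eigenvalues isolate the summand of `α`. -/
theorem rv_lead_mem (hg : Generic q t) (α : Fin (m + 1) → ℕ) :
    rv (lead hg α) ∈ leadSpan q⁻¹ t⁻¹ (sz α) (orb q t α) := by
  classical
  have hOd : ∀ β ∈ orb q t α, sz β = sz α := fun β hβ => hβ.1
  have hi := hg.inv
  set O := (finite_of_sz_eq hOd).toFinset with hOdef
  have hmem (β) : β ∈ O ↔ β ∈ orb q t α := by simp [O]
  let R : MvPolynomial (Fin (m + 1)) F := ∑ β ∈ O, basis hg β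
  let P : MvPolynomial (Fin (m + 1)) F := ∑ β ∈ O, lead hg β
  have hRd : R.totalDegree ≤ sz α := totalDegree_finsetSum_le fun β hβ => by
    rw [← hOd β ((hmem β).mp hβ)]; exact totalDegree_basis_le hg β
  have hReval (γ : Fin (m + 1) → ℕ) (hγ : sz γ ≤ sz α) :
      eval (spec q t γ) R = if γ ∈ O then 1 else 0 := by
    rw [map_sum, ← Finset.sum_ite_eq O γ (fun _ => (1 : F))]
    refine Finset.sum_congr rfl fun β hβ => ?_
    have hs := hOd β ((hmem β).mp hβ)
    split_ifs with h
    · subst h; exact eval_basis_self hg γ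
    · exact eval_basis_ne hg (by omega) h
  have hRP : homogeneousComponent (sz α) R = P := by
    rw [map_sum]
    refine Finset.sum_congr rfl fun β hβ => ?_
    rw [lead, hOd β ((hmem β).mp hβ)]
  -- The values of `R` up to size `|α|` are those of an indicator function invariant under
  -- exchanges, so both sides agree at all these spectral vectors.
  have hRT (i : Fin m) : T t i R = C t * R := by
    rw [← sub_eq_zero]
    refine hg.eq_zero (d := sz α) ((totalDegree_sub _ _).trans (max_le (totalDegree_T_le i hRd)
      ((totalDegree_mul _ _).trans (by simpa using hRd)))) fun γ hγ => ?_
    rw [map_sub, map_mul, eval_C, sub_eq_zero]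
    by_cases h : γ i.castSucc = γ i.succ
    · rw [eval_T_of_eq _ _ _ (hg.spec_castSucc h)]
    · have h1 := eval_T_mul t i (spec q t γ) R
      have h2 : γ ∘ adj i ∈ O ↔ γ ∈ O := by
        simp only [hmem, orb, Set.mem_ofPred_eq, sz_adj, sum_spec_adj]
      rw [← spec_adj h, hReval (γ ∘ adj i) (by rwa [sz_adj]), hReval γ hγ] at h1
      rw [hReval γ hγ]
      simp only [h2, sub_self, mul_zero, add_zero] at h1
      rw [mul_comm t, mul_assoc] at h1
      refine mul_left_cancel₀ (sub_ne_zero.mpr fun h3 => h (hg.spec_eq h3).1) h1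
  have hPsw (i : Fin m) : sw i P = P := by
    rw [← hRP]
    have := homogeneousComponent_map (sw (F := F) i).toLinearMap 0
      (fun k f hf => hf.rename_isHomogeneous) R (sz α)
    rw [AlgHom.toLinearMap_apply, AlgHom.toLinearMap_apply, sw_of_T (hRT i)] at this
    exact this.symm
  have hPd : P.IsHomogeneous (sz α) := hRP ▸ homogeneousComponent_isHomogeneous _ _
  have hPK : ∑ i, opKL q t i P = (t ^ m * ∑ k, spec q t α k) • P := by
    have h1 (i) : opKL q t i P = ∑ β ∈ O, (t ^ m * spec q t β i) • lead hg β := by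
      rw [map_sum]
      exact Finset.sum_congr rfl fun β _ => opK_lead hg β i
    rw [Finset.sum_congr rfl fun i _ => h1 i, Finset.sum_comm, Finset.smul_sum]
    refine Finset.sum_congr rfl fun β hβ => ?_
    rw [← Finset.sum_smul, ← Finset.mul_sum, ((hmem β).mp hβ).2]
  -- Reversal carries `T_i` and `ω⁻¹` for `q, t` to operators for inverted parameters that preserve
  -- the span; hence `W` is stable under every `opKL`.
  let W : Submodule F (MvPolynomial (Fin (m + 1)) F) :=
    (leadSpan q⁻¹ t⁻¹ (sz α) (orb q t α)).comap (rv (F := F) (n := m + 1)).toLinearMap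
  have hW (p) : p ∈ W ↔ rv p ∈ leadSpan q⁻¹ t⁻¹ (sz α) (orb q t α) := Iff.rfl
  have hPW : P ∈ W := by
    rw [hW, rv_of_sw hPsw]
    exact mem_leadSpan_inv hg α hPsw hPd hPK
  have hWT : ∀ p ∈ W, ∀ i : Fin m, T t i p ∈ W := by
    intro p hp i
    rw [hW, rv_T hg.t_ne]
    exact Submodule.smul_mem _ _ (Th_mem_of_T_mem hp
      (T_mem_leadSpan hi (swapClosed_orb q t α) _ hp))
  have hWo : ∀ p ∈ W, omInv q p ∈ W := by
    intro p hp
    rw [hW, rv_omInv]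
    exact om_mem_leadSpan hi (swapClosed_orb q t α) hOd hp
  have hWK : ∀ i, ∀ p ∈ W, opKL q t i p ∈ W := fun i p hp =>
    iter_Th_mem hWT i (hWo _ (opBr_mem hWT i hp))
  refine mem_of_sum_mem W (opKL q t) hWK (lead hg) (fun β i => t ^ m * spec q t β i)
    (opK_lead hg) ?_ O α ((hmem α).mpr ⟨rfl, rfl⟩) (fun _ => 1) one_ne_zero (by simpa using hPW)
  intro β γ h
  funext i
  exact (hg.spec_eq (mul_left_cancel₀ (pow_ne_zero m hg.t_ne) (congrFun h i))).1

/-- The roots, on the line through `τ`, of the lift with inverted parameters of a multiple of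
the reversed leading part of an interpolation polynomial. -/
theorem eval_primed_root (hg : Generic q t) (α : Fin n → ℕ)
    (hsep : ∀ β : Fin n → ℕ, ∑ k, spec q t β k = ∑ k, spec q t α k → ∀ j, cnt β j = cnt α j)
    {f : MvPolynomial (Fin n) F} {c : F} (hd : f.totalDegree ≤ sz α)
    (htop : homogeneousComponent (sz α) f = c • rv (lead hg α))
    (hv : VanishOn q⁻¹ t⁻¹ {β | sz β < sz α} f) {i j : ℕ} (h : i < cnt α j) :
    eval (fun k : Fin n => q⁻¹ ^ j * t⁻¹⁻¹ ^ i * t⁻¹⁻¹ ^ (k : ℕ)) f = 0 := by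
  cases n with
  | zero => simp [cnt] at h
  | succ m =>
    have hi := hg.inv
    obtain ⟨g, h1, h2, h3⟩ := Submodule.smul_mem _ c (rv_lead_mem hg α)
    have hOd : ∀ β ∈ orb q t α, sz β = sz α := fun β hβ => hβ.1
    have hfg : f = g := by
      refine hi.eq_of_homogeneousComponent_eq hd h1 (htop.trans h3.symm) fun β hβ => ?_
      rw [hv β hβ, h2 β ⟨hβ.le, fun hO => hβ.ne (hOd β hO)⟩]
    rw [hfg, eq_sum_basis hi hOd h1 h2, map_sum]
    refine Finset.sum_eq_zero fun β hβ => ?_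
    have hβ : β ∈ orb q t α := by simpa using hβ
    rw [smul_eval, eval_basis_root hi β (by rwa [hsep β hβ.2 j]), mul_zero]

end Lift

/-! ### Arm and leg sums counted by columns -/

section Boxes
variable {n : ℕ}

theorem sum_Icc_sub (a : ℕ) : ∑ j ∈ Finset.Icc 1 a, (a - j) = ∑ j ∈ Finset.range a, j := by
  refine Finset.sum_nbij' (fun j => a - j) (fun j => a - j) ?_ ?_ ?_ ?_ ?_ <;> intro j hj <;>
    simp at hj ⊢ <;> omega

theorem sum_Icc_eq_sum_range (a : ℕ) (f : ℕ → ℕ) :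
    ∑ j ∈ Finset.Icc 1 a, f j = ∑ j ∈ Finset.range a, f (j + 1) := by
  refine Finset.sum_nbij' (fun j => j - 1) (fun j => j + 1) ?_ ?_ ?_ ?_ ?_ <;> intro j hj <;>
    simp at hj ⊢
  · omega
  · omega
  · omega
  · congr 1; omega

theorem sum_range_eq_sum_ite {a D : ℕ} (h : a ≤ D) (f : ℕ → ℕ) :
    ∑ j ∈ Finset.range a, f j = ∑ j ∈ Finset.range D, if j < a then f j else 0 := by
  rw [← Finset.sum_filter]
  congr 1
  ext j; simp; omega

theorem le_sz (α : Fin n → ℕ) (k : Fin n) : α k ≤ sz α :=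
  Finset.single_le_sum (f := α) (fun _ _ => Nat.zero_le _) (Finset.mem_univ k)

theorem armSum_eq (α : Fin n → ℕ) :
    InterpolationMacdonald.armSum α = ∑ j ∈ Finset.range (sz α), j * cnt α j := by
  unfold InterpolationMacdonald.armSum cnt
  simp only [sum_Icc_sub, Finset.mul_sum]
  rw [Finset.sum_comm]
  refine Finset.sum_congr rfl fun k _ => ?_
  rw [sum_range_eq_sum_ite (le_sz α k)]
  simp

theorem lt_iff_lt_cnt {α : Fin n → ℕ} (hα : Antitone α) (j : ℕ) (k : Fin n) :
    j < α k ↔ (k : ℕ) < cnt α j := by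
  unfold cnt
  rw [← Finset.card_filter]
  constructor
  · intro h
    have : Finset.Iic k ⊆ Finset.univ.filter fun k => j < α k := by
      intro l hl
      simp at hl ⊢
      exact h.trans_le (hα hl)
    have := Finset.card_le_card this
    rw [Fin.card_Iic] at this
    omega
  · intro h
    by_contra h0
    have : (Finset.univ.filter fun k => j < α k) ⊆ Finset.Iio k := by
      intro l hl
      simp at hl ⊢
      by_contra h1
      exact h0 (hl.trans_le (hα (not_lt.mp h1)))
    have := Finset.card_le_card this
    rw [Fin.card_Iio] at this
    omega

theorem cnt_le (α : Fin n → ℕ) (j : ℕ) : cnt α j ≤ n := by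
  unfold cnt
  rw [← Finset.card_filter]
  exact (Finset.card_filter_le _ _).trans (by simp)

/-- For a partition the second set in the leg is empty, so in each column the legs count pairs of
boxes. Counted by the lower box, the box in row `k` contributes `k`. -/
theorem legSum_eq {α : Fin n → ℕ} (hα : Antitone α) :
    InterpolationMacdonald.legSum α =
      ∑ j ∈ Finset.range (sz α), ∑ i ∈ Finset.range (cnt α j), i := by
  have hleg (i : Fin n) (j : ℕ) (hj : j < α i) : InterpolationMacdonald.leg α i (j + 1) =
      ∑ k, if i < k ∧ j < α k then 1 else 0 := by
    unfold InterpolationMacdonald.leg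
    rw [← Finset.card_filter]
    have h2 : (Finset.univ.filter fun k : Fin n => k < i ∧ j + 1 ≤ α k + 1 ∧ α k + 1 ≤ α i) = ∅ := by
      rw [Finset.filter_eq_empty_iff]
      rintro k _ ⟨h1, _, h3⟩
      have := hα h1.le
      omega
    rw [h2, Finset.card_empty, add_zero]
    congr 1
    ext k
    simp only [Finset.mem_filter, Finset.mem_univ, true_and]
    refine and_congr_right fun h => ⟨fun h1 => h1.1, fun h1 => ⟨h1, hα h.le⟩⟩
  unfold InterpolationMacdonald.legSum
  have h1 (i : Fin n) : ∑ j ∈ Finset.Icc 1 (α i), InterpolationMacdonald.leg α i j =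
      ∑ j ∈ Finset.range (sz α), ∑ k, if i < k ∧ j < α k then 1 else 0 := by
    rw [sum_Icc_eq_sum_range, Finset.sum_congr rfl fun j hj => hleg i j (Finset.mem_range.mp hj),
      sum_range_eq_sum_ite (le_sz α i)]
    refine Finset.sum_congr rfl fun j _ => ?_
    split_ifs with h
    · rfl
    · symm
      refine Finset.sum_eq_zero fun k _ => if_neg ?_
      rintro ⟨h2, h3⟩
      exact h (h3.trans_le (hα h2.le))
  rw [Finset.sum_congr rfl fun i _ => h1 i, Finset.sum_comm]
  refine Finset.sum_congr rfl fun j _ => ?_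
  rw [Finset.sum_comm, sum_range_eq_sum_ite (cnt_le α j),
    ← Fin.sum_univ_eq_sum_range (fun i => if i < cnt α j then i else 0)]
  refine Finset.sum_congr rfl fun k _ => ?_
  simp only [lt_iff_lt_cnt hα]
  split_ifs with h
  · simp only [h, and_true]
    rw [← Finset.card_filter, show Finset.univ.filter (fun i => i < k) = Finset.Iio k by ext; simp,
      Fin.card_Iio]
  · simp [h]

theorem legSum_plus_eq (α : Fin n → ℕ) :
    InterpolationMacdonald.legSum (InterpolationMacdonald.plus α) =
      ∑ j ∈ Finset.range (sz α), ∑ i ∈ Finset.range (cnt α j), i := by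
  have hanti : Antitone (InterpolationMacdonald.plus α) := fun i j h =>
    Tuple.monotone_sort (fun k => OrderDual.toDual (α k)) h
  have hsz : sz (InterpolationMacdonald.plus α) = sz α :=
    Equiv.sum_comp (Tuple.sort fun k => OrderDual.toDual (α k)) α
  have hcnt (j : ℕ) : cnt (InterpolationMacdonald.plus α) j = cnt α j :=
    Equiv.sum_comp (Tuple.sort fun k => OrderDual.toDual (α k)) fun k => if j < α k then 1 else 0
  rw [legSum_eq hanti, hsz]
  simp only [hcnt]

theorem prod_boxes {F : Type*} [Field F] (q t : F) (α : Fin n → ℕ) :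
    ∏ j ∈ Finset.range (sz α), ∏ i ∈ Finset.range (cnt α j), (q ^ j * t⁻¹ ^ i) =
      q ^ InterpolationMacdonald.armSum α *
        t⁻¹ ^ InterpolationMacdonald.legSum (InterpolationMacdonald.plus α) := by
  rw [armSum_eq, legSum_plus_eq, ← Finset.prod_pow_eq_pow_sum, ← Finset.prod_pow_eq_pow_sum,
    ← Finset.prod_mul_distrib]
  refine Finset.prod_congr rfl fun j _ => ?_
  rw [Finset.prod_mul_distrib, Finset.prod_const, Finset.card_range, ← pow_mul,
    Finset.prod_pow_eq_pow_sum]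

theorem prod_boxes_const {F : Type*} [Field F] (c : F) (α : Fin n → ℕ) :
    ∏ j ∈ Finset.range (sz α), ∏ _i ∈ Finset.range (cnt α j), c = c ^ sz α := by
  simp only [Finset.prod_const, Finset.card_range]
  rw [Finset.prod_pow_eq_pow_sum, sum_cnt α (le_sz α)]

end Boxes

/-! ### The concrete spectral vectors over `ℚ(q,t)` -/

section Spectral
variable {n : ℕ}
open InterpolationMacdonald (BaseField ParamField bar tilde toInt kIndex)

theorem kIndex_toInt (β : Fin n → ℕ) (i : Fin n) : kIndex (toInt β) i = rank β i := by
  unfold kIndex rank dom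
  rw [Finset.card_filter, Finset.card_filter, ← Finset.sum_add_distrib]
  refine Finset.sum_congr rfl fun k _ => ?_
  simp only [toInt, Nat.cast_le, Nat.cast_lt]
  rcases lt_trichotomy k i with h | h | h
  · simp only [h, h.not_gt, true_and, false_and, and_true, if_false, add_zero]
    congr 1; simp; omega
  · simp [h]
  · simp [h, h.not_gt]

theorem bar_toInt (β : Fin n → ℕ) :
    bar (toInt β) = spec InterpolationMacdonald.q InterpolationMacdonald.t β := by
  funext i
  simp [bar, spec, kIndex_toInt, toInt]

/-- Negation with reversal inverts the order of entries, ties included: each `k ≠ i` is counted by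
exactly one of the two terms, and the `1` stands for `k = i`. -/
theorem kIndex_neg_rev (β : Fin n → ℕ) (i : Fin n) :
    kIndex (fun i => -toInt β i.rev) i + rank β i.rev + 1 = n := by
  unfold kIndex rank
  rw [Finset.card_filter, Finset.card_filter, ← Finset.sum_add_distrib,
    ← Equiv.sum_comp Fin.revPerm (fun k => if dom β k i.rev then 1 else 0),
    ← Finset.sum_add_distrib]
  have h1 : ∑ k, (if k = i then 1 else 0) = 1 := by simp
  have h2 : ∑ _k : Fin n, 1 = n := by simp
  conv_lhs => rw [← h1]
  rw [← Finset.sum_add_distrib]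
  conv_rhs => rw [← h2]
  refine Finset.sum_congr rfl fun k _ => ?_
  simp only [dom, toInt, Fin.revPerm_apply, Fin.rev_lt_rev, neg_le_neg_iff, neg_lt_neg_iff,
    Nat.cast_le, Nat.cast_lt]
  rcases lt_trichotomy k i with h | h | h
  · simp only [h, h.not_gt, h.ne, true_and, false_and, and_false, or_false, if_false]
    split_ifs <;> omega
  · simp [h]
  · simp only [h, h.not_gt, h.ne', true_and, false_and, and_true, if_false]
    split_ifs <;> omega

theorem tilde_toInt (ht : InterpolationMacdonald.t ≠ 0) (β : Fin n → ℕ) (i : Fin n) :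
    tilde (toInt β) i = InterpolationMacdonald.t⁻¹ ^ (n - 1) *
      spec InterpolationMacdonald.q⁻¹ InterpolationMacdonald.t⁻¹ β i.rev := by
  have h := kIndex_neg_rev β i
  have h1 : n - 1 = kIndex (fun i => -toInt β i.rev) i + rank β i.rev := by omega
  unfold tilde bar spec
  rw [h1]
  simp only [toInt, zpow_neg, zpow_natCast, inv_inv, pow_add, inv_pow]
  field_simp

theorem algebraMap_monomial (x y : ℕ) :
    algebraMap (MvPolynomial (Fin 2) ℚ) BaseField (monomial (Finsupp.single 0 x +
      Finsupp.single 1 y) 1) = InterpolationMacdonald.q ^ x * InterpolationMacdonald.t ^ y := by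
  rw [InterpolationMacdonald.q, InterpolationMacdonald.t, ← map_pow, ← map_pow, ← map_mul,
    X_pow_eq_monomial, X_pow_eq_monomial, monomial_mul, one_mul]

theorem algebraMap_base_injective :
    Function.Injective (algebraMap (MvPolynomial (Fin 2) ℚ) BaseField) :=
  IsFractionRing.injective _ _

theorem generic_base : Generic InterpolationMacdonald.q InterpolationMacdonald.t := by
  have hq : InterpolationMacdonald.q ≠ 0 := by
    rw [InterpolationMacdonald.q, Ne, map_eq_zero_iff _ algebraMap_base_injective]
    exact X_ne_zero _
  have ht : InterpolationMacdonald.t ≠ 0 := by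
    rw [InterpolationMacdonald.t, Ne, map_eq_zero_iff _ algebraMap_base_injective]
    exact X_ne_zero _
  refine ⟨hq, ht, fun x y h => ?_⟩
  have h1 : InterpolationMacdonald.q ^ x.toNat * InterpolationMacdonald.t ^ y.toNat =
      InterpolationMacdonald.q ^ (-x).toNat * InterpolationMacdonald.t ^ (-y).toNat := by
    have hx : x = x.toNat - (-x).toNat := by omega
    have hy : y = y.toNat - (-y).toNat := by omega
    rw [hx, hy, zpow_sub₀ hq, zpow_sub₀ ht, div_mul_div_comm, div_eq_one_iff_eq] at h
    · simpa only [zpow_natCast] using h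
    · exact mul_ne_zero (zpow_ne_zero _ hq) (zpow_ne_zero _ ht)
  rw [← algebraMap_monomial, ← algebraMap_monomial] at h1
  have h2 := monomial_left_injective one_ne_zero (algebraMap_base_injective h1)
  have h3 := DFunLike.congr_fun h2 0
  have h4 := DFunLike.congr_fun h2 1
  simp at h3 h4
  omega

theorem rank_le (β : Fin n → ℕ) (i : Fin n) : rank β i ≤ n := by
  unfold rank
  rw [← Finset.card_filter]
  exact (Finset.card_filter_le _ _).trans (by simp)

/-- After multiplication by `t^n` the spectral sum is a polynomial in `q, t` whose monomials record
the entries as exponents of `q`. The functional `φ` counts the monomials with exponent above `j`. -/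
theorem cnt_eq_of_sum_spec_eq {α β : Fin n → ℕ}
    (h : ∑ k, spec InterpolationMacdonald.q InterpolationMacdonald.t β k =
      ∑ k, spec InterpolationMacdonald.q InterpolationMacdonald.t α k) (j : ℕ) :
    cnt β j = cnt α j := by
  have ht := generic_base.t_ne
  have key (γ : Fin n → ℕ) : InterpolationMacdonald.t ^ n *
      ∑ k, spec InterpolationMacdonald.q InterpolationMacdonald.t γ k =
      algebraMap (MvPolynomial (Fin 2) ℚ) BaseField (∑ k, monomial (Finsupp.single 0 (γ k) +
        Finsupp.single 1 (n - rank γ k)) 1) := by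
    rw [map_sum, Finset.mul_sum]
    refine Finset.sum_congr rfl fun k _ => ?_
    rw [algebraMap_monomial, pow_sub₀ _ ht (rank_le γ k), spec, inv_pow]
    ring
  have h1 := algebraMap_base_injective
    ((key β).symm.trans ((congrArg _ h).trans (key α)))
  let φ : MvPolynomial (Fin 2) ℚ →ₗ[ℚ] ℚ :=
    (basisMonomials (Fin 2) ℚ).constr ℚ fun u => if j < u 0 then 1 else 0
  have hφ (u : Fin 2 →₀ ℕ) : φ (monomial u 1) = if j < u 0 then 1 else 0 := by
    rw [← (basisMonomials (Fin 2) ℚ).constr_basis ℚ (fun u => if j < u 0 then (1 : ℚ) else 0) u,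
      coe_basisMonomials]
  have hφs (γ : Fin n → ℕ) : φ (∑ k, monomial (Finsupp.single 0 (γ k) +
        Finsupp.single 1 (n - rank γ k)) 1) = (cnt γ j : ℚ) := by
    rw [map_sum, cnt, Nat.cast_sum]
    refine Finset.sum_congr rfl fun k _ => ?_
    rw [hφ]
    simp
  have h2 := congrArg φ h1
  rw [hφs, hφs] at h2
  exact_mod_cast h2

end Spectral

/-! ### Reversal and rescaling of the variables -/

section Scale
variable {F : Type*} [Field F] {n : ℕ}

/-- `f(x₁, …, xₙ) ↦ f(c xₙ, …, c x₁)`. -/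
def scaleRev (c : F) : MvPolynomial (Fin n) F →ₐ[F] MvPolynomial (Fin n) F :=
  aeval fun i => C c * X i.rev

theorem aeval_scaleRev {A : Type*} [CommRing A] [Algebra F A] (c : F) (x : Fin n → A)
    (f : MvPolynomial (Fin n) F) :
    aeval x (scaleRev c f) = aeval (fun i => algebraMap F A c * x i.rev) f := by
  rw [scaleRev, comp_aeval_apply]
  congr 2; funext i
  simp [← algebraMap_eq]

theorem eval_scaleRev (c : F) (x : Fin n → F) (f : MvPolynomial (Fin n) F) :
    eval x (scaleRev c f) = eval (fun i => c * x i.rev) f :=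
  aeval_scaleRev c x f

theorem scaleRev_scaleRev {c d : F} (h : c * d = 1) (f : MvPolynomial (Fin n) F) :
    scaleRev c (scaleRev d f) = f := by
  conv_lhs => rw [scaleRev, aeval_scaleRev]
  conv_rhs => rw [← aeval_X_left_apply f]
  congr 2; funext i
  rw [Fin.rev_rev, algebraMap_eq, ← mul_assoc, ← C_mul, mul_comm d, h, C_1, one_mul]

theorem scaleRev_of_isHomogeneous (c : F) {d : ℕ} {f : MvPolynomial (Fin n) F}
    (hf : f.IsHomogeneous d) : scaleRev c f = c ^ d • rv f := by
  rw [scaleRev, aeval_mul_of_isHomogeneous hf, ← C_pow, smul_eq_C_mul]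
  congr 1
  have : aeval (fun i => X i.rev) = rv (F := F) (n := n) := by
    apply algHom_ext
    intro i
    simp [rv]
  rw [this]

theorem isHomogeneous_scaleRev (c : F) (d : ℕ) (f : MvPolynomial (Fin n) F)
    (hf : f.IsHomogeneous d) : (scaleRev c f).IsHomogeneous d := by
  rw [scaleRev_of_isHomogeneous c hf, smul_eq_C_mul]
  have := (isHomogeneous_C (Fin n) (c ^ d)).mul (hf.rename_isHomogeneous (f := Fin.rev))
  rwa [zero_add] at this

theorem totalDegree_scaleRev_le (c : F) {d : ℕ} {f : MvPolynomial (Fin n) F}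
    (hf : f.totalDegree ≤ d) : (scaleRev c f).totalDegree ≤ d :=
  totalDegree_le_of_isHomogeneous_map (scaleRev c).toLinearMap (isHomogeneous_scaleRev c) f hf

theorem homogeneousComponent_scaleRev (c : F) (d : ℕ) (f : MvPolynomial (Fin n) F) :
    homogeneousComponent d (scaleRev c f) = scaleRev c (homogeneousComponent d f) :=
  homogeneousComponent_map (scaleRev c).toLinearMap 0 (isHomogeneous_scaleRev c) f d

end Scale

/-! ### Factorization of both polynomials along the line through `τ` -/

section Main
variable {n : ℕ}
open InterpolationMacdonald (BaseField ParamField bar tilde toInt IsInterpolation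
  IsPrimedInterpolation G GPrime size tauComp evalTau tau)

local notation "𝐪" => InterpolationMacdonald.q
local notation "𝐭" => InterpolationMacdonald.t
local notation "𝐚" => InterpolationMacdonald.a

theorem existsUnique_isInterpolation (α : Fin n → ℕ) : ∃! P, IsInterpolation α P := by
  obtain ⟨f, h1, h2, h3⟩ := generic_base.exists_normalized α
  refine ⟨f, ⟨h1, fun β hβ hne => ?_, h3⟩, fun g hg => ?_⟩
  · rw [bar_toInt]; exact h2 β hβ hne
  · refine generic_base.normalized_unique α hg.degree_le h1 (fun β hβ hne => ?_) ?_
    · rw [h2 β hβ hne, ← bar_toInt]; exact hg.vanishing β hβ hne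
    · rw [h3, hg.normalized]

theorem isInterpolation_G (α : Fin n → ℕ) : IsInterpolation α (G α) :=
  Classical.epsilon_spec (existsUnique_isInterpolation α).exists

theorem G_eq (α : Fin n → ℕ) :
    G α = eval (spec 𝐪 𝐭 α) (G α) • basis generic_base α := by
  have hG := isInterpolation_G α
  rw [← sub_eq_zero]
  refine generic_base.eq_zero (d := sz α) ((totalDegree_sub _ _).trans (max_le hG.degree_le
    ((totalDegree_smul_le _ _).trans (totalDegree_basis_le _ α)))) fun β hβ => ?_
  rw [map_sub, smul_eval]
  by_cases h : β = α
  · subst h; rw [eval_basis_self]; ring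
  · rw [eval_basis_ne _ hβ h, ← bar_toInt β, hG.vanishing β hβ h]; ring

theorem scale_mul_scale : 𝐭 ^ (n - 1) * 𝐭⁻¹ ^ (n - 1) = 1 := by
  rw [← mul_pow, mul_inv_cancel₀ generic_base.t_ne, one_pow]

theorem eval_tilde (β : Fin n → ℕ) (f : MvPolynomial (Fin n) BaseField) :
    eval (tilde (toInt β)) f = eval (spec 𝐪⁻¹ 𝐭⁻¹ β) (scaleRev (𝐭⁻¹ ^ (n - 1)) f) := by
  rw [eval_scaleRev]
  congr 2; funext i
  exact tilde_toInt generic_base.t_ne β i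

theorem existsUnique_isPrimedInterpolation (α : Fin n → ℕ) :
    ∃! P, IsPrimedInterpolation α P := by
  have hc := scale_mul_scale (n := n)
  have hc' : 𝐭⁻¹ ^ (n - 1) * 𝐭 ^ (n - 1) = 1 := by rw [mul_comm, hc]
  obtain ⟨f, h1, h2, h3⟩ := generic_base.inv.exists_lift (isHomogeneous_scaleRev (𝐭⁻¹ ^ (n - 1))
    (sz α) _ (homogeneousComponent_isHomogeneous (sz α) (G α)))
  refine ⟨scaleRev (𝐭 ^ (n - 1)) f, ⟨totalDegree_scaleRev_le _ h1, ?_, fun β hβ => ?_⟩,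
    fun g hg => ?_⟩
  · change homogeneousComponent (sz α) _ = homogeneousComponent (sz α) _
    rw [homogeneousComponent_scaleRev, h2, scaleRev_scaleRev hc]
  · rw [eval_tilde, scaleRev_scaleRev hc']
    exact h3 β hβ
  · rw [← scaleRev_scaleRev hc g]
    congr 1
    refine generic_base.inv.eq_of_homogeneousComponent_eq
      (totalDegree_scaleRev_le _ hg.degree_le) h1 ?_ fun β hβ => ?_
    · change homogeneousComponent (sz α) _ = homogeneousComponent (sz α) _
      rw [h2, homogeneousComponent_scaleRev]
      exact congrArg _ hg.top_eq
    · rw [h3 β hβ, ← eval_tilde]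
      exact hg.vanishing β hβ

theorem isPrimedInterpolation_GPrime (α : Fin n → ℕ) : IsPrimedInterpolation α (GPrime α) :=
  Classical.epsilon_spec (existsUnique_isPrimedInterpolation α).exists

theorem tau_eq (i : Fin n) : tau n i = 𝐭⁻¹ ^ (i : ℕ) := by simp [tau]

theorem evalTau_G (α : Fin n → ℕ) (c : ParamField) :
    evalTau (G α) c = algebraMap BaseField ParamField
        (eval (fun k : Fin n => 𝐭⁻¹ ^ (k : ℕ)) (homogeneousComponent (sz α) (G α))) *
      ∏ j ∈ Finset.range (sz α), ∏ i ∈ Finset.range (cnt α j),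
        (c - algebraMap BaseField ParamField (𝐪 ^ j * 𝐭⁻¹ ^ i)) := by
  rw [← aeval_tau_eq generic_base α (isInterpolation_G α).degree_le]
  · simp only [evalTau, tau_eq]
  · intro i j h
    rw [G_eq, smul_eval, eval_basis_root _ _ h, mul_zero]

theorem evalTau_GPrime (α : Fin n → ℕ) (c : ParamField) :
    evalTau (GPrime α) c = algebraMap BaseField ParamField
        (eval (fun k : Fin n => 𝐭⁻¹ ^ (k : ℕ)) (homogeneousComponent (sz α) (G α))) *
      ∏ j ∈ Finset.range (sz α), ∏ i ∈ Finset.range (cnt α j),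
        (c - algebraMap BaseField ParamField (𝐪⁻¹ ^ j * 𝐭⁻¹⁻¹ ^ i)) := by
  have hG := isPrimedInterpolation_GPrime α
  have ht := generic_base.t_ne
  -- Reversal and scaling by `t^{1-n}` carry the vector `τ` for `t⁻¹` to the one for `t`, so both
  -- factorizations have the same leading coefficient.
  have htau (i : Fin n) : 𝐭⁻¹ ^ (n - 1) * 𝐭⁻¹⁻¹ ^ (i.rev : ℕ) = 𝐭⁻¹ ^ (i : ℕ) := by
    have h1 : n - 1 = (i.rev : ℕ) + i := by rw [Fin.val_rev]; omega
    rw [h1, pow_add, inv_pow, inv_inv, mul_right_comm, inv_mul_cancel₀ (pow_ne_zero _ ht), one_mul]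
  have htop : homogeneousComponent (sz α) (scaleRev (𝐭⁻¹ ^ (n - 1)) (GPrime α)) =
      scaleRev (𝐭⁻¹ ^ (n - 1)) (homogeneousComponent (sz α) (G α)) := by
    rw [homogeneousComponent_scaleRev]
    exact congrArg _ hG.top_eq
  have key := aeval_tau_eq generic_base.inv (K := ParamField) α
    (totalDegree_scaleRev_le (𝐭⁻¹ ^ (n - 1)) hG.degree_le) (fun i j h =>
      eval_primed_root generic_base α (fun β => cnt_eq_of_sum_spec_eq)
        (c := (𝐭⁻¹ ^ (n - 1)) ^ sz α * eval (spec 𝐪 𝐭 α) (G α))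
        (totalDegree_scaleRev_le (𝐭⁻¹ ^ (n - 1)) hG.degree_le) (by
          rw [htop, scaleRev_of_isHomogeneous _ (homogeneousComponent_isHomogeneous _ _)]
          conv_lhs => rw [G_eq, map_smul, map_smul]
          rw [smul_smul, lead]) (fun β hβ => by
          rw [← eval_tilde]; exact hG.vanishing β hβ) h) c
  rw [htop, eval_scaleRev, aeval_scaleRev] at key
  simp only [htau] at key
  rw [← key, evalTau]
  congr 2; funext i
  rw [tau_eq, ← htau i, map_mul]
  ring

/-- Factorwise this is `x⁻¹ - r⁻¹ = -(x r)⁻¹ (x - r)`; there are `|α|` factors in total. -/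
theorem prod_inv_sub {K : Type*} [Field K] (α : Fin n → ℕ) {x : K} (hx : x ≠ 0)
    {r : ℕ → ℕ → K} (hr : ∀ i j, r i j ≠ 0) :
    ∏ j ∈ Finset.range (sz α), ∏ i ∈ Finset.range (cnt α j), (x⁻¹ - (r i j)⁻¹) =
      ((-1) ^ sz α * ∏ j ∈ Finset.range (sz α), ∏ i ∈ Finset.range (cnt α j), r i j)⁻¹ *
        x⁻¹ ^ sz α * ∏ j ∈ Finset.range (sz α), ∏ i ∈ Finset.range (cnt α j), (x - r i j) := by
  rw [mul_inv, ← inv_pow, ← prod_boxes_const, ← prod_boxes_const x⁻¹]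
  simp only [← Finset.prod_inv_distrib, ← Finset.prod_mul_distrib]
  refine Finset.prod_congr rfl fun j _ => Finset.prod_congr rfl fun i _ => ?_
  have := hr i j
  field_simp
  ring

end Main

end NonsymInterp

end

theorem mainTheorem7 (n : ℕ) (α : Fin n → ℕ) :
    (∃! P, InterpolationMacdonald.IsInterpolation α P) ∧
    (∃! P, InterpolationMacdonald.IsPrimedInterpolation α P) ∧
    InterpolationMacdonald.evalTau (InterpolationMacdonald.GPrime α) InterpolationMacdonald.a⁻¹ =
      (algebraMap InterpolationMacdonald.BaseField InterpolationMacdonald.ParamField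
          (InterpolationMacdonald.tauComp α))⁻¹ *
        InterpolationMacdonald.a ^ (-(InterpolationMacdonald.size α : ℤ)) *
        InterpolationMacdonald.evalTau (InterpolationMacdonald.G α) InterpolationMacdonald.a := by
  refine ⟨NonsymInterp.existsUnique_isInterpolation α,
    NonsymInterp.existsUnique_isPrimedInterpolation α, ?_⟩
  have hg := NonsymInterp.generic_base
  have ha : InterpolationMacdonald.a ≠ 0 := RatFunc.X_ne_zero
  have hτ : InterpolationMacdonald.tauComp α = (-1) ^ NonsymInterp.sz α *
      ∏ j ∈ Finset.range (NonsymInterp.sz α), ∏ i ∈ Finset.range (NonsymInterp.cnt α j),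
        (InterpolationMacdonald.q ^ j * InterpolationMacdonald.t⁻¹ ^ i) := by
    rw [NonsymInterp.prod_boxes, InterpolationMacdonald.tauComp, zpow_neg, zpow_natCast, inv_pow,
      mul_assoc]
    rfl
  have hinv (i j : ℕ) : InterpolationMacdonald.q⁻¹ ^ j * InterpolationMacdonald.t⁻¹⁻¹ ^ i =
      (InterpolationMacdonald.q ^ j * InterpolationMacdonald.t⁻¹ ^ i)⁻¹ := by
    rw [mul_inv, inv_pow, inv_pow InterpolationMacdonald.t⁻¹]
  rw [NonsymInterp.evalTau_G, NonsymInterp.evalTau_GPrime]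
  simp only [hinv, map_inv₀]
  rw [NonsymInterp.prod_inv_sub α ha (r := fun i j => algebraMap InterpolationMacdonald.BaseField
    InterpolationMacdonald.ParamField
      (InterpolationMacdonald.q ^ j * InterpolationMacdonald.t⁻¹ ^ i)), hτ]
  · simp only [map_mul, map_prod, map_pow, map_neg, map_one, zpow_neg, zpow_natCast, inv_pow]
    rw [show InterpolationMacdonald.size α = NonsymInterp.sz α from rfl]
    ring
  · intro i j
    rw [Ne, map_eq_zero]
    exact mul_ne_zero (pow_ne_zero _ hg.q_ne) (pow_ne_zero _ (inv_ne_zero hg.t_ne))
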